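/- Let $d\in\mathbb N$, $T>0$, and let $\Omega\subset\mathbb R^d$ be a bounded domain with smooth boundary. Put $Q=\Omega\times(0,T)$, $\Sigma=\partial\Omega\times(0,T)$, where $\Sigma$ carries the measure $d\sigma\,dt$ with $\sigma$ the surface measure of $\partial\Omega$. Let $c_0\in(\frac1{\sqrt2},1)$ and $H\in C([0,T];\mathbb R^d)$ with $H(0)=0$. Assume that there are $T_1\in(0,T]$ and $\rho>0$ with $H\in C^1([0,T_1];\mathbb R^d)$ and $|H'(t)|\ge\rho$ for all $t\in[0,T_1]$. Define $$t_1=\sup\Big\{\tau\in[0,T_1]\ :\ \frac{H'(t)}{|H'(t)|}\cdot\frac{H'(0)}{|H'(0)|}\ge c_0\ \text{ for all } t\in[0,\tau]\Big\}.$$ Suppose that there is a point $x_0\in\mathbb R^d\setminus\overline\Omega$ such that $$\frac{H'(t)\cdot(x-x_0)}{|H'(t)|\,|x-x_0|}\ge 2c_0^2-1\qquad\text{for all }(x,t)\in\overline\Omega\times[0,t_1],$$ and such that $T_0<t_1$, where $$T_0=\sqrt{\frac{\max_{x\in\overline\Omega}|x-x_0|^2-\min_{x\in\overline\Omega}|x-x_0|^2}{\delta}},\qquad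 \delta=\rho\,(2c_0^2-1)\,\mathrm{dist}(x_0,\Omega).$$ Then there is a constant $C>0$ such that for every $g\in L^2(\Sigma)$ and every real-valued $u\in H^1(Q)$ satisfying $\partial_tu+H(t)\cdot\nabla u=0$ in $Q$ and $u=g$ on $\Sigma$ (in the sense of traces), $$\|u(\cdot,t)\|_{L^2(\Omega)}\le C\,\|g\|_{L^2(\Sigma)}\qquad\text{for all }t\in[0,T],$$ where $t\mapsto u(\cdot,t)$ denotes the continuous representative of $u$ in $C([0,T];L^2(\Omega))$. -/

import Mathlib

open MeasureTheory Set Filter Topology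
open scoped ContDiff

noncomputable section

namespace Transport

/-- Euclidean space `ℝ^d`. -/
abbrev E (d : ℕ) : Type := EuclideanSpace ℝ (Fin d)

variable {d : ℕ}

/-! ### Domains and the space-time cylinder -/

/-- `Ω ⊆ ℝ^d` is a bounded domain with smooth boundary: it is open, connected, nonempty, bounded,
and near each boundary point it is the sublevel set `{φ < 0}` of a smooth function `φ` whose
differential does not vanish at that point. -/
structure IsSmoothBoundedDomain (Ω : Set (E d)) : Prop where
  isOpen : IsOpen Ω
  isConnected : IsConnected Ω
  isBounded : Bornology.IsBounded Ω
  smooth_boundary : ∀ p ∈ frontier Ω, ∃ U : Set (E d), IsOpen U ∧ p ∈ U ∧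
    ∃ φ : E d → ℝ, ContDiff ℝ ∞ φ ∧ fderiv ℝ φ p ≠ 0 ∧ Ω ∩ U = {x ∈ U | φ x < 0}

/-- The cylinder `Q = Ω × (0, T)`. -/
def cylinder (Ω : Set (E d)) (T : ℝ) : Set (E d × ℝ) := Ω ×ˢ Ioo 0 T

/-- Lebesgue measure on `Ω`. -/
def interiorMeasure (Ω : Set (E d)) : Measure (E d) := volume.restrict Ω

/-- The surface measure `σ` of `∂Ω`: the `(d-1)`-dimensional Hausdorff measure, normalized to agree
with Lebesgue measure on Euclidean spaces of dimension `d-1`. -/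
def surfaceMeasure (Ω : Set (E d)) : Measure (E d) :=
  (Measure.euclideanHausdorffMeasure (d - 1)).restrict (frontier Ω)

/-- The measure `dσ dt` of the lateral boundary `Σ = ∂Ω × (0, T)`. -/
def lateralMeasure (Ω : Set (E d)) (T : ℝ) : Measure (E d × ℝ) :=
  (surfaceMeasure Ω).prod (volume.restrict (Ioo 0 T))

/-! ### The Sobolev space `H¹(Q)` -/

/-- The classical time derivative `∂ₜφ`. -/
def timeDeriv (φ : E d × ℝ → ℝ) (p : E d × ℝ) : ℝ := fderiv ℝ φ p (0, 1)

/-- The classical space gradient `∇φ`. -/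
def spaceGrad (φ : E d × ℝ → ℝ) (p : E d × ℝ) : E d := gradient (fun x => φ (x, p.2)) p.1

/-- Test functions on `Q`: smooth functions with compact support contained in `Q`. -/
structure IsTestFunction (Q : Set (E d × ℝ)) (φ : E d × ℝ → ℝ) : Prop where
  contDiff : ContDiff ℝ ∞ φ
  hasCompactSupport : HasCompactSupport φ
  tsupport_subset : tsupport φ ⊆ Q

/-- A function of the Sobolev space `H¹(Q)`, together with its weak derivatives (which are
determined by the function up to null sets). -/
structure H1 (Q : Set (E d × ℝ)) where
  /-- the function -/
  val : E d × ℝ → ℝ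
  /-- the weak time derivative `∂ₜu` -/
  dt : E d × ℝ → ℝ
  /-- the weak space gradient `∇u` -/
  grad : E d × ℝ → E d
  memLp_val : MemLp val 2 (volume.restrict Q)
  memLp_dt : MemLp dt 2 (volume.restrict Q)
  memLp_grad : MemLp grad 2 (volume.restrict Q)
  weak_dt : ∀ φ, IsTestFunction Q φ →
    ∫ p in Q, val p * timeDeriv φ p = -∫ p in Q, φ p * dt p
  weak_grad : ∀ φ, IsTestFunction Q φ →
    ∫ p in Q, val p • spaceGrad φ p = -∫ p in Q, φ p • grad p

/-- `u = g` on `Σ` in the sense of traces. The trace operator is the continuous extension of the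
restriction map `v ↦ v|_Σ` from functions smooth up to the boundary to `H¹(Q)`; so `g` is the trace
of `u` if there are smooth `v n` with `v n → u` in `H¹(Q)` and `v n|_Σ → g` in `L²(Σ)`. -/
def HasLateralTrace (Ω : Set (E d)) (T : ℝ) (u : H1 (cylinder Ω T))
    (g : Lp ℝ 2 (lateralMeasure Ω T)) : Prop :=
  ∃ v : ℕ → E d × ℝ → ℝ, (∀ n, ContDiff ℝ ∞ (v n)) ∧
    Tendsto (fun n => eLpNorm (fun p => v n p - u.val p) 2 (volume.restrict (cylinder Ω T)))
      atTop (𝓝 0) ∧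
    Tendsto (fun n => eLpNorm (fun p => timeDeriv (v n) p - u.dt p) 2
      (volume.restrict (cylinder Ω T))) atTop (𝓝 0) ∧
    Tendsto (fun n => eLpNorm (fun p => spaceGrad (v n) p - u.grad p) 2
      (volume.restrict (cylinder Ω T))) atTop (𝓝 0) ∧
    Tendsto (fun n => eLpNorm (fun p => v n p - g p) 2 (lateralMeasure Ω T)) atTop (𝓝 0)

/-- `U t = u(·, t)` as an element of `L²(Ω)`, for every `t ∈ [0, T]`: `U` is the continuous
representative of `u`, i.e. `U ∈ C([0, T]; L²(Ω))` and `U t = u(·, t)` for almost every `t`. -/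
def IsTimeSlice (Ω : Set (E d)) (T : ℝ) (u : H1 (cylinder Ω T))
    (U : ℝ → Lp ℝ 2 (interiorMeasure Ω)) : Prop :=
  ContinuousOn U (Icc 0 T) ∧
    ∀ᵐ t ∂(volume.restrict (Ioo 0 T)), U t =ᵐ[interiorMeasure Ω] fun x => u.val (x, t)

/-- `u ∈ H¹(Q)` solves `∂ₜu + H(t)·∇u = 0` in `Q` and `u = g` on `Σ`. -/
structure IsSolution (Ω : Set (E d)) (T : ℝ) (H : ℝ → E d) (g : Lp ℝ 2 (lateralMeasure Ω T))
    (u : H1 (cylinder Ω T)) : Prop where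
  equation : ∀ᵐ p ∂(volume.restrict (cylinder Ω T)), u.dt p + inner ℝ (H p.2) (u.grad p) = 0
  boundary : HasLateralTrace Ω T u g

/-! ### The times `t₁` and `T₀` -/

/-- The derivative `H'` of `H` on `[0, T₁]` (one-sided at the endpoints). -/
def deriv1 (H : ℝ → E d) (T₁ : ℝ) (t : ℝ) : E d := derivWithin H (Icc 0 T₁) t

/-- `t₁`: the supremum of all `τ ∈ [0, T₁]` such that
`H'(t)/|H'(t)| · H'(0)/|H'(0)| ≥ c₀` for all `t ∈ [0, τ]`. -/
def turningTime (H : ℝ → E d) (T₁ c₀ : ℝ) : ℝ :=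
  sSup {τ ∈ Icc 0 T₁ | ∀ t ∈ Icc 0 τ,
    c₀ ≤ inner ℝ (‖deriv1 H T₁ t‖⁻¹ • deriv1 H T₁ t) (‖deriv1 H T₁ 0‖⁻¹ • deriv1 H T₁ 0)}

/-- `δ = ρ (2 c₀² - 1) dist(x₀, Ω)`. -/
def delta (Ω : Set (E d)) (ρ c₀ : ℝ) (x₀ : E d) : ℝ :=
  ρ * (2 * c₀ ^ 2 - 1) * Metric.infDist x₀ Ω

/-- `T₀ = √((max |x - x₀|² - min |x - x₀|²) / δ)`, the extrema being over `x ∈ closure Ω`. -/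
def exitTime (Ω : Set (E d)) (ρ c₀ : ℝ) (x₀ : E d) : ℝ :=
  Real.sqrt ((sSup ((fun x => ‖x - x₀‖ ^ 2) '' closure Ω)
    - sInf ((fun x => ‖x - x₀‖ ^ 2) '' closure Ω)) / delta Ω ρ c₀ x₀)

end Transport

end

/-! The proof is a weighted energy argument with weight `ψ(x,t) = |x - x₀|² - δt²`. Since `H(0) =
0`, integrating the angle condition in time gives `H(t)·(x - x₀) ≥ δt` on `[0, t₁]`
(`delta_mul_le_inner`), so `ψ` does not decrease along the flow `∂ₜ + H·∇`. Hence for a solution `∫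
u²ψ` can decrease on `[0, t₁]` only through the lateral boundary, while `∫ u²` is conserved on `[0,
T]` up to boundary terms. With `m ≤ |x - x₀|² ≤ M` on `Ω`, `ψ ≥ m` at time `0` and `ψ ≤ M - δt₁²` at
time `t₁`. The condition `T₀ < t₁` says `M - δt₁² < m`, so both facts can hold only if `∫ u(·,0)²`
is bounded by the boundary data, and conservation carries the bound to every `t`
(`exists_integral_sq_le`).

Boundary fluxes need only an upper bound, so the divergence theorem is replaced by an inequality
with constant `4` (`enorm_integral_partialDeriv_le`). It comes from difference quotients: the set
between `Ω` and its translate by `h • e` lies in a sweep of the frontier, whose volume is `O(h)`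
times Hausdorff measure (`volume_sweep_le`).

The estimate is proved for smooth functions with an error `‖v‖ ‖∂ₜv + H·∇v‖`. Applied to differences
of the functions approximating the trace, it makes their time slices uniformly Cauchy in `L²(Ω)`.
The limit is the continuous representative and inherits the bound (`exists_isTimeSlice`). -/

noncomputable section

namespace Transport

/-! ### Volume of swept sets against Hausdorff measure -/

/-- The projection of `ℝ^{n+1}` forgetting the `i`-th coordinate. -/
def dropCoord {n : ℕ} (i : Fin (n + 1)) (x : E (n + 1)) : E n :=
  WithLp.toLp 2 fun j => x (i.succAbove j)

/-- The `i`-th standard unit vector. -/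
def unitVec {d : ℕ} (i : Fin d) : E d := EuclideanSpace.single i 1

/-- The set swept by `A` when it moves by at most `h` in the direction of the `i`-th axis. -/
def sweep {d : ℕ} (i : Fin d) (h : ℝ) (A : Set (E d)) : Set (E d) :=
  {x | ∃ p ∈ A, ∃ s ∈ Icc 0 h, x = p + s • unitVec i}

lemma lipschitzWith_dropCoord {n : ℕ} (i : Fin (n + 1)) : LipschitzWith 1 (dropCoord i) := by
  refine LipschitzWith.of_dist_le_mul fun x y => ?_
  rw [NNReal.coe_one, one_mul, EuclideanSpace.dist_eq, EuclideanSpace.dist_eq]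
  refine Real.sqrt_le_sqrt ?_
  rw [Fin.sum_univ_succAbove _ i]
  simp only [dropCoord]
  linarith [sq_nonneg (dist (x i) (y i))]

/-- A 1-Lipschitz map does not increase Hausdorff measure, and the normalizing factor depends only
on `n`, so it is the same in both spaces. -/
lemma volume_dropCoord_image_le {n : ℕ} (i : Fin (n + 1)) (A : Set (E (n + 1))) :
    volume (dropCoord i '' A) ≤ Measure.euclideanHausdorffMeasure n A := by
  rw [← EuclideanSpace.euclideanHausdorffMeasure_eq_volume,
    Measure.euclideanHausdorffMeasure_def, Measure.euclideanHausdorffMeasure_def,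
    Measure.smul_apply, Measure.smul_apply]
  have := (lipschitzWith_dropCoord i).hausdorffMeasure_image_le (d := n) (by positivity) A
  simp only [ENNReal.coe_one, ENNReal.one_rpow, one_mul] at this
  gcongr

lemma volume_dropCoord_mem {n : ℕ} (i : Fin (n + 1)) (B : Set (E n)) (J : Set ℝ) :
    volume {x : E (n + 1) | dropCoord i x ∈ B ∧ x i ∈ J} = volume J * volume B := by
  have h1 := EuclideanSpace.volume_preserving_symm_measurableEquiv_toLp (Fin (n + 1))
  have h2 := volume_preserving_piFinSuccAbove (fun _ : Fin (n + 1) => ℝ) i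
  have h3 := EuclideanSpace.volume_preserving_symm_measurableEquiv_toLp (Fin n)
  have e1 : {x : E (n + 1) | dropCoord i x ∈ B ∧ x i ∈ J} =
      (MeasurableEquiv.toLp 2 (Fin (n + 1) → ℝ)).symm ⁻¹'
        ((MeasurableEquiv.piFinSuccAbove (fun _ : Fin (n + 1) => ℝ) i) ⁻¹'
          (J ×ˢ ((MeasurableEquiv.toLp 2 (Fin n → ℝ)) ⁻¹' B))) := by
    ext x
    simp only [mem_ofPred_eq, mem_preimage, mem_prod]
    rw [and_comm]
    rfl
  rw [e1, h1.measure_preimage_equiv, h2.measure_preimage_equiv, Measure.volume_eq_prod,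
    Measure.prod_prod]
  congr 1
  exact h3.symm.measure_preimage_equiv B

/-- Cut `A` into slabs of thickness `h` across the axis. Sweeping one slab by at most `h` stays in a
cylinder of height `2h` over its projection, whose volume is controlled by the slab's Hausdorff
measure. -/
lemma volume_sweep_le {n : ℕ} (i : Fin (n + 1)) {h : ℝ} (hh : 0 < h) (A : Set (E (n + 1))) :
    volume (sweep i h A) ≤ ENNReal.ofReal (2 * h) * Measure.euclideanHausdorffMeasure n A := by
  set μ : Measure (E (n + 1)) := Measure.euclideanHausdorffMeasure n
  set S : ℤ → Set (E (n + 1)) := fun j => {x | x i ∈ Ico (j * h) ((j + 1) * h)}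
  have hcont : Continuous fun x : E (n + 1) => x i := by fun_prop
  have hS : ∀ j, MeasurableSet (S j) := fun j => hcont.measurable measurableSet_Ico
  have hdisj : Pairwise (Function.onFun Disjoint S) := by
    intro j k hjk
    refine Set.disjoint_left.2 fun x hx hx' => hjk ?_
    have a1 : (j : ℝ) < k + 1 := lt_of_mul_lt_mul_right (hx.1.trans_lt hx'.2) hh.le
    have a2 : (k : ℝ) < j + 1 := lt_of_mul_lt_mul_right (hx'.1.trans_lt hx.2) hh.le
    have b1 : j < k + 1 := by exact_mod_cast a1
    have b2 : k < j + 1 := by exact_mod_cast a2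
    omega
  have hcov : sweep i h A ⊆ ⋃ j : ℤ, {x | dropCoord i x ∈ dropCoord i '' (A ∩ S j) ∧
      x i ∈ Icc (j * h) ((j + 2) * h)} := by
    rintro x ⟨p, hp, s, hs, rfl⟩
    have hf1 := Int.floor_le (p i / h)
    have hf2 := Int.lt_floor_add_one (p i / h)
    rw [le_div_iff₀ hh] at hf1
    rw [div_lt_iff₀ hh] at hf2
    refine mem_iUnion.2 ⟨⌊p i / h⌋, ⟨p, ⟨hp, hf1, hf2⟩, ?_⟩, ?_⟩
    · ext j
      simp [dropCoord, unitVec]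
    · have : (p + s • unitVec i) i = p i + s := by simp [unitVec]
      rw [this]
      constructor <;> nlinarith [hs.1, hs.2]
  calc volume (sweep i h A)
      ≤ ∑' j : ℤ, volume {x | dropCoord i x ∈ dropCoord i '' (A ∩ S j) ∧
      x i ∈ Icc (j * h) ((j + 2) * h)} := (measure_mono hcov).trans (measure_iUnion_le _)
    _ ≤ ∑' j : ℤ, ENNReal.ofReal (2 * h) * μ (A ∩ S j) := by
        refine ENNReal.tsum_le_tsum fun j => ?_
        rw [volume_dropCoord_mem, Real.volume_Icc,
          show ((j : ℝ) + 2) * h - j * h = 2 * h by ring]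
        gcongr
        exact volume_dropCoord_image_le i _
    -- Restricting `μ` to `A` makes additivity a matter of the measurable slabs `S j`, so `A` may be
    -- arbitrary.
    _ = ENNReal.ofReal (2 * h) * ∑' j : ℤ, μ.restrict A (S j) := by
        rw [ENNReal.tsum_mul_left]
        congr 2
        ext j
        rw [Measure.restrict_apply (hS j), inter_comm]
    _ = ENNReal.ofReal (2 * h) * μ.restrict A (⋃ j, S j) := by
        rw [measure_iUnion hdisj hS]
    _ ≤ ENNReal.ofReal (2 * h) * μ A := by
        refine mul_le_mul_right (((measure_mono (subset_univ _)).trans_eq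
          (Measure.restrict_apply_univ _))) _

/-- Layer-cake form of `volume_sweep_le`: the part of `S` where `|f| > t` lies in the sweep of the
part of `K` where `2|f| > t`. The constant is `2h` from the sweep times `2` from the comparison of
values. -/
lemma setLIntegral_sweep_le {n : ℕ} (i : Fin (n + 1)) {h : ℝ} (hh : 0 < h) {K S : Set (E (n + 1))}
    {f : E (n + 1) → ℝ} (hf : Continuous f)
    (hSK : ∀ x ∈ S, ∃ p ∈ K, (∃ s ∈ Icc 0 h, x = p + s • unitVec i) ∧ |f x| ≤ 2 * |f p|) :
    ∫⁻ x in S, ‖f x‖ₑ ≤ ENNReal.ofReal (4 * h) *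
      ∫⁻ x in K, ‖f x‖ₑ ∂(Measure.euclideanHausdorffMeasure n) := by
  set μ : Measure (E (n + 1)) := Measure.euclideanHausdorffMeasure n
  have e1 : ∫⁻ x in S, ‖f x‖ₑ = ∫⁻ x in S, ENNReal.ofReal |f x| := by
    simp [Real.enorm_eq_ofReal_abs]
  have e2 : ENNReal.ofReal (4 * h) * ∫⁻ x in K, ‖f x‖ₑ ∂μ =
      ENNReal.ofReal (2 * h) * ∫⁻ x in K, ENNReal.ofReal (2 * |f x|) ∂μ := by
    rw [show 4 * h = 2 * h * 2 by ring, ENNReal.ofReal_mul (by positivity), mul_assoc]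
    congr 1
    rw [← lintegral_const_mul _ (by fun_prop)]
    simp [Real.enorm_eq_ofReal_abs, ENNReal.ofReal_mul]
  rw [e1, e2, lintegral_eq_lintegral_meas_lt _ (ae_of_all _ fun x => abs_nonneg _)
      (by fun_prop), lintegral_eq_lintegral_meas_lt _ (ae_of_all _ fun x => by positivity)
      (by fun_prop), ← lintegral_const_mul' _ _ ENNReal.ofReal_ne_top]
  refine lintegral_mono fun t => ?_
  have m1 : MeasurableSet {x | t < |f x|} := (isOpen_lt continuous_const hf.abs).measurableSet
  have m2 : MeasurableSet {x | t < 2 * |f x|} :=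
    (isOpen_lt continuous_const (continuous_const.mul hf.abs)).measurableSet
  rw [Measure.restrict_apply m1, Measure.restrict_apply m2]
  refine (measure_mono ?_).trans (volume_sweep_le i hh _)
  rintro x ⟨hx, hxS⟩
  obtain ⟨p, hp, ⟨s, hs, hxp⟩, hle⟩ := hSK x hxS
  exact ⟨p, ⟨lt_of_lt_of_le hx hle, hp⟩, s, hs, hxp⟩

/-! ### Translates of a domain and a weak divergence theorem -/

variable {d : ℕ}

lemma norm_unitVec (i : Fin d) : ‖unitVec i‖ = 1 := by simp [unitVec]

lemma isOpen_translate {Ω : Set (E d)} (hΩ : IsOpen Ω) (a : E d) : IsOpen {x | x - a ∈ Ω} :=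
  hΩ.preimage (by fun_prop)

lemma tendsto_volume_diff_translate {Ω : Set (E d)} (hΩ : IsOpen Ω) (hb : Bornology.IsBounded Ω)
    (e : E d) :
    Tendsto (fun h : ℝ => volume (Ω \ {x | x - h • e ∈ Ω})) (𝓝 0) (𝓝 0) := by
  rw [← measure_empty (μ := (volume : Measure (E d)))]
  refine tendsto_measure_of_tendsto_indicator (𝓝 0)
    (fun h => hΩ.measurableSet.diff (isOpen_translate hΩ _).measurableSet) hΩ.measurableSet
    hb.measure_lt_top.ne (Eventually.of_forall fun h => sdiff_subset) fun x => ?_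
  by_cases hx : x ∈ Ω
  · have hc : Tendsto (fun h : ℝ => x - h • e) (𝓝 0) (𝓝 x) := by
      have : Continuous fun h : ℝ => x - h • e := by fun_prop
      simpa using this.tendsto 0
    filter_upwards [hc (hΩ.mem_nhds hx)] with h hh
    simp only [Set.mem_sdiff, mem_empty_iff_false, iff_false, not_and, not_not]
    exact fun _ => hh
  · simp [hx]

/-- The symmetric difference of `Ω` and its translate by `a`. -/
def shiftDiff (Ω : Set (E d)) (a : E d) : Set (E d) :=
  (Ω \ {x | x - a ∈ Ω}) ∪ ({x | x - a ∈ Ω} \ Ω)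

lemma measurableSet_shiftDiff {Ω : Set (E d)} (hΩ : IsOpen Ω) (a : E d) :
    MeasurableSet (shiftDiff Ω a) :=
  (hΩ.measurableSet.diff (isOpen_translate hΩ _).measurableSet).union
    ((isOpen_translate hΩ _).measurableSet.diff hΩ.measurableSet)

lemma tendsto_volume_shiftDiff {Ω : Set (E d)} (hΩ : IsOpen Ω) (hb : Bornology.IsBounded Ω)
    (e : E d) : Tendsto (fun h : ℝ => volume (shiftDiff Ω (h • e))) (𝓝 0) (𝓝 0) := by
  have h1 := tendsto_volume_diff_translate hΩ hb e
  have h2 : Tendsto (fun h : ℝ => volume ({x | x - h • e ∈ Ω} \ Ω)) (𝓝 0) (𝓝 0) := by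
    have hn : Tendsto (fun h : ℝ => -h) (𝓝 0) (𝓝 0) := by
      simpa using (continuous_neg (G := ℝ)).tendsto 0
    refine (h1.comp hn).congr fun h => ?_
    -- This half is a translate of the other half taken with `-h`, so it has the same volume.
    have : {x | x - h • e ∈ Ω} \ Ω = (fun x => x + -(h • e)) ⁻¹' (Ω \ {x | x - -h • e ∈ Ω}) := by
      ext x
      simp [sub_eq_add_neg]
    rw [this, measure_preimage_add_right]
    rfl
  have h3 := h1.add h2
  rw [add_zero] at h3
  exact tendsto_of_tendsto_of_tendsto_of_le_of_le tendsto_const_nhds h3 (fun _ => zero_le)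
    fun h => measure_union_le _ _

lemma inter_frontier_nonempty_of_isPreconnected {X : Type*} [TopologicalSpace X] {S U : Set X}
    (hS : IsPreconnected S) (hU : IsOpen U) {a b : X} (ha : a ∈ S) (haU : a ∈ U) (hb : b ∈ S)
    (hbU : b ∉ U) : (S ∩ frontier U).Nonempty := by
  by_contra hne
  rw [not_nonempty_iff_eq_empty] at hne
  have hf : ∀ x ∈ S, x ∉ U → x ∉ closure U := fun x hx hxU hxc => by
    have : x ∈ S ∩ frontier U := ⟨hx, by rw [hU.frontier_eq]; exact ⟨hxc, hxU⟩⟩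
    rw [hne] at this
    exact this
  obtain ⟨x, -, hx1, hx2⟩ := hS U (closure U)ᶜ hU isClosed_closure.isOpen_compl
    (fun x hx => (em (x ∈ U)).imp id (hf x hx)) ⟨a, ha, haU⟩ ⟨b, hb, hf b hb hbU⟩
  exact hx2 (subset_closure hx1)

lemma exists_frontier_of_mem_shiftDiff {Ω : Set (E d)} (hΩ : IsOpen Ω) (e : E d) {h : ℝ} (hh : 0 ≤ h) {x : E d}
    (hx : x ∈ shiftDiff Ω (h • e)) : ∃ s ∈ Icc 0 h, x - s • e ∈ frontier Ω := by
  have hseg : IsPreconnected ((fun s : ℝ => x - s • e) '' Icc 0 h) :=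
    isPreconnected_Icc.image _ (by fun_prop)
  have m0 : x ∈ (fun s : ℝ => x - s • e) '' Icc 0 h := ⟨0, ⟨le_rfl, hh⟩, by simp⟩
  have m1 : x - h • e ∈ (fun s : ℝ => x - s • e) '' Icc 0 h := ⟨h, ⟨hh, le_rfl⟩, rfl⟩
  have key : ((fun s : ℝ => x - s • e) '' Icc 0 h ∩ frontier Ω).Nonempty := by
    rcases hx with ⟨hx1, hx2⟩ | ⟨hx1, hx2⟩
    · exact inter_frontier_nonempty_of_isPreconnected hseg hΩ m0 hx1 m1 hx2
    · exact inter_frontier_nonempty_of_isPreconnected hseg hΩ m1 hx1 m0 hx2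
  obtain ⟨_, ⟨s, hs, rfl⟩, hf⟩ := key
  exact ⟨s, hs, hf⟩

/-- After a change of variables, `G` is integrated against the difference of the indicators of the
translate and of `Ω`, which vanishes off `shiftDiff Ω a` and has modulus one there. -/
lemma enorm_integral_shift_sub_le {Ω : Set (E d)} (hΩ : IsOpen Ω) (hb : Bornology.IsBounded Ω)
    {G : E d → ℝ} (hG : Continuous G) (a : E d) :
    ‖∫ x in Ω, (G (x + a) - G x)‖ₑ ≤ ∫⁻ x in shiftDiff Ω a, ‖G x‖ₑ := by
  have hint : ∀ {g : E d → ℝ} {s : Set (E d)}, Continuous g → Bornology.IsBounded s →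
      IntegrableOn g s := fun hg hs =>
    (hg.continuousOn.integrableOn_compact hs.isCompact_closure).mono_set subset_closure
  have hΩ' := (isOpen_translate hΩ a).measurableSet
  have hb' : Bornology.IsBounded {x | x - a ∈ Ω} := by
    have : {x | x - a ∈ Ω} = (fun x => a + x) '' Ω := by
      ext x
      constructor
      · exact fun hx => ⟨x - a, hx, by simp⟩
      · rintro ⟨y, hy, rfl⟩
        simpa using hy
    rw [this]
    exact (LipschitzWith.of_dist_le_mul (K := 1) (by simp)).isBounded_image hb
  have e1 : ∫ x in Ω, G (x + a) = ∫ x in {x | x - a ∈ Ω}, G x := by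
    rw [← integral_indicator hΩ.measurableSet, ← integral_indicator hΩ',
      ← integral_add_right_eq_self (indicator _ G) a]
    refine integral_congr_ae (ae_of_all _ fun x => ?_)
    by_cases hx : x ∈ Ω <;> simp [indicator, hx]
  rw [integral_sub (hint (by fun_prop) hb) (hint hG hb), e1, ← integral_indicator hΩ.measurableSet,
    ← integral_indicator hΩ', ← integral_sub ((integrable_indicator_iff hΩ').2 (hint hG hb'))
      ((integrable_indicator_iff hΩ.measurableSet).2 (hint hG hb))]
  refine (enorm_integral_le_lintegral_enorm _).trans ?_
  rw [← lintegral_indicator (measurableSet_shiftDiff hΩ a)]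
  refine lintegral_mono fun x => ?_
  by_cases h1 : x ∈ Ω <;> by_cases h2 : x - a ∈ Ω <;> simp [indicator, shiftDiff, h1, h2]

/-- A weak form of the divergence theorem: the integral of a partial derivative over a bounded
open set is controlled by the integral of the absolute value over the frontier. -/
theorem enorm_integral_partialDeriv_le {Ω : Set (E d)} (hΩ : IsOpen Ω)
    (hb : Bornology.IsBounded Ω) (i : Fin d) {G G' : E d → ℝ} (hG : Continuous G)
    (hG' : Continuous G')
    (hder : ∀ x (s : ℝ), HasDerivAt (fun s : ℝ => G (x + s • unitVec i)) (G' (x + s • unitVec i)) s) :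
    ‖∫ x in Ω, G' x‖ₑ ≤ 4 * ∫⁻ x, ‖G x‖ₑ ∂(surfaceMeasure Ω) := by
  obtain ⟨n, rfl⟩ : ∃ n, d = n + 1 := ⟨d - 1, by have := i.2; omega⟩
  set e := unitVec i with he
  have hne : ‖e‖ = 1 := norm_unitVec i
  obtain ⟨R, hR⟩ := hb.subset_closedBall 0
  -- The radius `R + 1` leaves room for shifts of length at most `1`.
  obtain ⟨L, hL⟩ := (isCompact_closedBall (0 : E (n + 1)) (R + 1)).exists_bound_of_continuousOn
    hG'.continuousOn
  have hL' : ∀ x ∈ Metric.closedBall (0 : E (n + 1)) (R + 1), ‖G' x‖ ≤ |L| :=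
    fun x hx => (hL x hx).trans (le_abs_self L)
  have hcl : closure Ω ⊆ Metric.closedBall 0 R := closure_minimal hR Metric.isClosed_closedBall
  have hlip : ∀ p ∈ closure Ω, ∀ s ∈ Icc (0 : ℝ) 1, |G (p + s • e) - G p| ≤ |L| * s := by
    intro p hp s hs
    have := (convex_Icc (0 : ℝ) s).norm_image_sub_le_of_norm_hasDerivWithin_le
      (f := fun s : ℝ => G (p + s • e)) (f' := fun s => G' (p + s • e)) (C := |L|)
      (fun r _ => (hder p r).hasDerivWithinAt) (fun r hr => hL' _ ?_)
      (left_mem_Icc.2 hs.1) (right_mem_Icc.2 hs.1)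
    · simpa [abs_of_nonneg hs.1] using this
    · have h1 := hcl hp
      rw [mem_closedBall_zero_iff] at h1 ⊢
      refine (norm_add_le _ _).trans ?_
      rw [norm_smul, hne, Real.norm_of_nonneg hr.1]
      linarith [hr.2, hs.2]
  set I := ∫⁻ x, ‖G x‖ₑ ∂(surfaceMeasure Ω) with hI
  -- Split `S` at `|G| = 2|L|h`. Where `|G|` is smaller, the integral divided by `h` is `O(|S|)`,
  -- which tends to `0`. Where it is larger, a frontier point `p` within distance `h` has `|G x - G
  -- p| ≤ |L|h < |G x|/2`, hence `|G x| ≤ 2|G p|`, and the sweep estimate gives `4h * I`.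
  have hbound : ∀ h ∈ Ioc (0 : ℝ) 1, ‖∫ x in Ω, h⁻¹ * (G (x + h • e) - G x)‖ₑ ≤
      4 * I + ENNReal.ofReal (2 * |L|) * volume (shiftDiff Ω (h • e)) := by
    intro h hh
    set S := shiftDiff Ω (h • e)
    have hSm : MeasurableSet S := measurableSet_shiftDiff hΩ _
    have hGm : MeasurableSet {x | |G x| ≤ 2 * |L| * h} :=
      (isClosed_le hG.abs continuous_const).measurableSet
    have s1 : ∫⁻ x in S ∩ {x | |G x| ≤ 2 * |L| * h}, ‖G x‖ₑ ≤
        ENNReal.ofReal (2 * |L| * h) * volume S := by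
      calc _ ≤ ∫⁻ x in S ∩ {x | |G x| ≤ 2 * |L| * h}, ENNReal.ofReal (2 * |L| * h) := by
            refine setLIntegral_mono measurable_const fun x hx => ?_
            rw [Real.enorm_eq_ofReal_abs]
            exact ENNReal.ofReal_le_ofReal hx.2
        _ ≤ _ := by
            rw [setLIntegral_const]
            gcongr
            exact inter_subset_left
    have s2 : ∫⁻ x in S \ {x | |G x| ≤ 2 * |L| * h}, ‖G x‖ₑ ≤ ENNReal.ofReal (4 * h) * I := by
      refine setLIntegral_sweep_le i hh.1 hG fun x hx => ?_
      obtain ⟨s, hs, hf⟩ := exists_frontier_of_mem_shiftDiff hΩ e hh.1.le hx.1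
      refine ⟨_, hf, ⟨s, hs, by simp [he]⟩, ?_⟩
      have h1 := hlip _ (frontier_subset_closure hf) s ⟨hs.1, hs.2.trans hh.2⟩
      rw [sub_add_cancel] at h1
      have h2 : 2 * |L| * h < |G x| := not_le.1 hx.2
      have h3 : |G x| - |G (x - s • e)| ≤ |G x - G (x - s • e)| := abs_sub_abs_le_abs_sub _ _
      have h4 : |L| * s ≤ |L| * h := mul_le_mul_of_nonneg_left hs.2 (abs_nonneg L)
      linarith
    have s3 : ∫⁻ x in S, ‖G x‖ₑ ≤ ENNReal.ofReal (2 * |L| * h) * volume S +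
        ENNReal.ofReal (4 * h) * I := by
      rw [← lintegral_inter_add_sdiff _ S hGm]
      exact add_le_add s1 s2
    have hh0 : ENNReal.ofReal h⁻¹ * ENNReal.ofReal h = 1 := by
      rw [← ENNReal.ofReal_mul (inv_nonneg.2 hh.1.le), inv_mul_cancel₀ hh.1.ne', ENNReal.ofReal_one]
    rw [integral_const_mul, enorm_mul, Real.enorm_eq_ofReal_abs, abs_of_pos (inv_pos.2 hh.1)]
    calc _ ≤ ENNReal.ofReal h⁻¹ * (ENNReal.ofReal (2 * |L| * h) * volume S +
          ENNReal.ofReal (4 * h) * I) := by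
          gcongr
          exact (enorm_integral_shift_sub_le hΩ hb hG _).trans s3
      _ = (ENNReal.ofReal h⁻¹ * ENNReal.ofReal h) *
          (4 * I + ENNReal.ofReal (2 * |L|) * volume S) := by
          rw [ENNReal.ofReal_mul (by positivity), ENNReal.ofReal_mul (by norm_num : (0 : ℝ) ≤ 4),
            show ENNReal.ofReal 4 = 4 by norm_num]
          ring
      _ = _ := by rw [hh0, one_mul]
  have hlim : Tendsto (fun h : ℝ => ∫ x in Ω, h⁻¹ * (G (x + h • e) - G x)) (𝓝[>] 0)
      (𝓝 (∫ x in Ω, G' x)) := by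
    refine tendsto_integral_filter_of_dominated_convergence (fun _ => |L|)
      (Eventually.of_forall fun h => ?_) ?_ ?_ ?_
    · exact Continuous.aestronglyMeasurable (by fun_prop)
    · filter_upwards [Ioc_mem_nhdsGT (zero_lt_one (α := ℝ))] with h hh
      refine (ae_restrict_iff' hΩ.measurableSet).2 (ae_of_all _ fun x hx => ?_)
      rw [norm_mul, Real.norm_of_nonneg (inv_nonneg.2 hh.1.le), Real.norm_eq_abs,
        inv_mul_le_iff₀ hh.1, mul_comm]
      exact hlip x (subset_closure hx) h ⟨hh.1.le, hh.2⟩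
    · exact integrableOn_const hb.measure_lt_top.ne
    · refine ae_of_all _ fun x => ?_
      have := (hder x 0).tendsto_slope_zero_right
      simpa using this
  have h5 := (hlim.enorm)
  have h6 : Tendsto (fun h : ℝ => 4 * I + ENNReal.ofReal (2 * |L|) * volume (shiftDiff Ω (h • e)))
      (𝓝[>] 0) (𝓝 (4 * I + ENNReal.ofReal (2 * |L|) * 0)) :=
    tendsto_const_nhds.add (ENNReal.Tendsto.const_mul
      ((tendsto_volume_shiftDiff hΩ hb e).mono_left nhdsWithin_le_nhds)
      (Or.inr ENNReal.ofReal_ne_top))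
  rw [mul_zero, add_zero] at h6
  exact le_of_tendsto_of_tendsto h5 h6 (by
    filter_upwards [Ioc_mem_nhdsGT (zero_lt_one (α := ℝ))] with h hh using hbound h hh)

/-! ### Balance law on the space-time cylinder -/

lemma hasDerivAt_intervalIntegral_of_continuous {f f' : ℝ → ℝ → ℝ}
    (hf : Continuous (Function.uncurry f)) (hf' : Continuous (Function.uncurry f'))
    (hder : ∀ r τ, HasDerivAt (fun r => f r τ) (f' r τ) r) (s t r₀ : ℝ) :
    HasDerivAt (fun r => ∫ τ in s..t, f r τ) (∫ τ in s..t, f' r₀ τ) r₀ := by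
  obtain ⟨C, hC⟩ := ((isCompact_Icc (a := r₀ - 1) (b := r₀ + 1)).prod
    (isCompact_uIcc (a := s) (b := t))).exists_bound_of_continuousOn hf'.continuousOn
  have c1 : ∀ r, Continuous (f r) := fun r => by
    exact hf.comp (by fun_prop : Continuous fun τ : ℝ => (r, τ))
  have c2 : ∀ r, Continuous (f' r) := fun r => by
    exact hf'.comp (by fun_prop : Continuous fun τ : ℝ => (r, τ))
  refine (intervalIntegral.hasDerivAt_integral_of_dominated_loc_of_deriv_le
    (bound := fun _ => C) (s := Icc (r₀ - 1) (r₀ + 1)) (Icc_mem_nhds (by linarith) (by linarith))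
    (Eventually.of_forall fun r => (c1 r).aestronglyMeasurable)
    ((c1 r₀).intervalIntegrable _ _) ((c2 r₀).aestronglyMeasurable)
    (ae_of_all _ fun τ hτ r hr => hC (r, τ) ⟨hr, uIoc_subset_uIcc hτ⟩)
    intervalIntegrable_const (ae_of_all _ fun τ _ r _ => hder r τ)).2

lemma integrable_prod_of_continuous {Ω : Set (E d)} (hb : Bornology.IsBounded Ω) (s t : ℝ)
    {f : E d × ℝ → ℝ} (hf : Continuous f) :
    Integrable f ((volume.restrict Ω).prod (volume.restrict (Ioc s t))) := by
  rw [Measure.prod_restrict]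
  refine (hf.continuousOn.integrableOn_compact
    (hb.isCompact_closure.prod (isCompact_Icc (a := s) (b := t)))).mono_set ?_
  exact prod_mono subset_closure Ioc_subset_Icc_self

lemma integral_cylinder_eq {Ω : Set (E d)} (hb : Bornology.IsBounded Ω) {s t : ℝ} (hst : s ≤ t)
    {f : E d × ℝ → ℝ} (hf : Continuous f) :
    ∫ p in Ω ×ˢ Ioc s t, f p = ∫ x in Ω, ∫ τ in s..t, f (x, τ) := by
  rw [Measure.volume_eq_prod, ← Measure.prod_restrict,
    integral_prod _ (integrable_prod_of_continuous hb s t hf)]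
  simp only [intervalIntegral.integral_of_le hst]

lemma hasDerivAt_line {F : E d × ℝ → ℝ} (hF : ContDiff ℝ 1 F) (x e : E d) (τ s : ℝ) :
    HasDerivAt (fun s : ℝ => F (x + s • e, τ)) (fderiv ℝ F (x + s • e, τ) (e, 0)) s := by
  have h1 : HasDerivAt (fun s : ℝ => (x + s • e, τ)) (e, (0 : ℝ)) s := by
    refine HasDerivAt.prodMk ?_ (hasDerivAt_const _ _)
    simpa using ((hasDerivAt_id s).smul_const e).const_add x
  exact ((hF.differentiable (by simp)) _).hasFDerivAt.comp_hasDerivAt s h1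

lemma hasDerivAt_time {F : E d × ℝ → ℝ} (hF : ContDiff ℝ 1 F) (x : E d) (τ : ℝ) :
    HasDerivAt (fun s : ℝ => F (x, s)) (fderiv ℝ F (x, τ) (0, 1)) τ :=
  ((hF.differentiable (by simp)) _).hasFDerivAt.comp_hasDerivAt τ
    ((hasDerivAt_const τ x).prodMk (hasDerivAt_id τ))

lemma lintegral_lateralMeasure (Ω : Set (E d)) (T : ℝ) {f : E d × ℝ → ENNReal}
    (hf : Measurable f) :
    ∫⁻ p, f p ∂(lateralMeasure Ω T) =
      ∫⁻ x, (∫⁻ τ in Ioo 0 T, f (x, τ)) ∂(surfaceMeasure Ω) :=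
  lintegral_prod _ hf.aemeasurable

/-- The flux of `F` along one coordinate direction. -/
lemma enorm_integral_coord_flux_le {Ω : Set (E d)} (hΩ : IsOpen Ω) (hb : Bornology.IsBounded Ω)
    {T M : ℝ} {a : ℝ → ℝ} (ha : Continuous a) (haM : ∀ t ∈ Icc 0 T, |a t| ≤ M)
    {F : E d × ℝ → ℝ} (hF : ContDiff ℝ 1 F) (i : Fin d) {s t : ℝ} (hs : 0 ≤ s) (hst : s ≤ t)
    (ht : t ≤ T) :
    ‖∫ p in Ω ×ˢ Ioc s t, a p.2 * fderiv ℝ F p (unitVec i, 0)‖ₑ ≤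
      4 * (ENNReal.ofReal M * ∫⁻ p, ‖F p‖ₑ ∂(lateralMeasure Ω T)) := by
  have hF' : Continuous fun p : E d × ℝ => fderiv ℝ F p (unitVec i, 0) :=
    (hF.continuous_fderiv (by simp)).clm_apply continuous_const
  have hFc := hF.continuous
  rw [integral_cylinder_eq hb hst (by fun_prop)]
  -- Integrating in time before space reduces the flux to a function of `x` alone, to which the
  -- spatial estimate applies.
  refine (enorm_integral_partialDeriv_le hΩ hb i (G := fun x => ∫ τ in s..t, a τ * F (x, τ))
    ?_ ?_ ?_).trans ?_
  · exact intervalIntegral.continuous_parametric_intervalIntegral_of_continuous' (by fun_prop) _ _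
  · exact intervalIntegral.continuous_parametric_intervalIntegral_of_continuous' (by fun_prop) _ _
  · intro x r
    refine hasDerivAt_intervalIntegral_of_continuous (f := fun r τ => a τ * F (x + r • unitVec i, τ))
      (f' := fun r τ => a τ * fderiv ℝ F (x + r • unitVec i, τ) (unitVec i, 0)) ?_ ?_ ?_ s t r
    · fun_prop
    · exact (ha.comp continuous_snd).mul (hF'.comp (by fun_prop :
        Continuous fun q : ℝ × ℝ => (x + q.1 • unitVec i, q.2)))
    · exact fun r τ => (hasDerivAt_line hF x _ τ r).const_mul _
  · gcongr
    rw [lintegral_lateralMeasure Ω T (by fun_prop),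
      ← lintegral_const_mul' _ _ ENNReal.ofReal_ne_top]
    refine lintegral_mono fun x => ?_
    rw [intervalIntegral.integral_of_le hst, ← lintegral_const_mul' _ _ ENNReal.ofReal_ne_top]
    refine (enorm_integral_le_lintegral_enorm _).trans ?_
    -- Adding the null endpoints lets the time domain contain `Ioc s t` even when `t = T`.
    rw [Measure.restrict_congr_set (Ioo_ae_eq_Icc (a := (0 : ℝ)) (b := T) (μ := volume))]
    have hsub : Ioc s t ⊆ Icc 0 T := fun τ hτ => ⟨hs.trans hτ.1.le, hτ.2.trans ht⟩
    refine (lintegral_mono_set hsub).trans (setLIntegral_mono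
      ((by fun_prop : Continuous fun τ => F (x, τ)).measurable.enorm.const_mul _) fun τ hτ => ?_)
    rw [enorm_mul]
    gcongr
    rw [Real.enorm_eq_ofReal_abs]
    exact ENNReal.ofReal_le_ofReal (haM τ hτ)

lemma fderiv_space_eq_sum (F : E d × ℝ → ℝ) (p : E d × ℝ) (w : E d) :
    fderiv ℝ F p (w, 0) = ∑ i, w i * fderiv ℝ F p (unitVec i, 0) := by
  have hw : w = ∑ i, w i • unitVec i := by
    ext j
    simp [unitVec, Pi.single_apply]
  have h1 : (w, (0 : ℝ)) = ContinuousLinearMap.inl ℝ (E d) ℝ (∑ i, w i • unitVec i) := by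
    rw [← hw]
    rfl
  rw [h1, map_sum, map_sum]
  simp only [map_smul, smul_eq_mul]
  rfl

/-- The rate of change of `∫_Ω F(x, t) dx` differs from the integral of the derivative of `F` along
the flow of `H` by a term controlled by the lateral boundary values of `F`. -/
theorem enorm_balance_le {Ω : Set (E d)} (hΩ : IsOpen Ω) (hb : Bornology.IsBounded Ω)
    {T M : ℝ} {H : ℝ → E d} (hH : Continuous H) (hHM : ∀ t ∈ Icc 0 T, ‖H t‖ ≤ M)
    {F : E d × ℝ → ℝ} (hF : ContDiff ℝ 1 F) {s t : ℝ} (hs : 0 ≤ s) (hst : s ≤ t) (ht : t ≤ T) :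
    ‖(∫ x in Ω, F (x, t)) - (∫ x in Ω, F (x, s)) -
      ∫ p in Ω ×ˢ Ioc s t, fderiv ℝ F p (H p.2, 1)‖ₑ ≤
      d * (4 * (ENNReal.ofReal M * ∫⁻ p, ‖F p‖ₑ ∂(lateralMeasure Ω T))) := by
  have hFc := hF.continuous
  have hF' := hF.continuous_fderiv (by simp)
  have hint : ∀ {f : E d × ℝ → ℝ}, Continuous f → IntegrableOn f (Ω ×ˢ Ioc s t) := by
    intro f hf
    have := integrable_prod_of_continuous hb s t hf
    rwa [Measure.prod_restrict] at this
  have hint' : ∀ τ : ℝ, IntegrableOn (fun x => F (x, τ)) Ω := fun τ =>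
    ((by fun_prop : Continuous fun x => F (x, τ)).continuousOn.integrableOn_compact
      hb.isCompact_closure).mono_set subset_closure
  have ct : Continuous fun p : E d × ℝ => fderiv ℝ F p (0, 1) := hF'.clm_apply continuous_const
  have cx : Continuous fun p : E d × ℝ => fderiv ℝ F p (H p.2, 0) :=
    hF'.clm_apply (by fun_prop)
  have ci : ∀ i, Continuous fun p : E d × ℝ => fderiv ℝ F p (unitVec i, 0) := fun i =>
    hF'.clm_apply continuous_const
  have e1 : (∫ x in Ω, F (x, t)) - (∫ x in Ω, F (x, s)) =
      ∫ p in Ω ×ˢ Ioc s t, fderiv ℝ F p (0, 1) := by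
    rw [← integral_sub (hint' t) (hint' s), integral_cylinder_eq hb hst ct]
    congr 1
    ext x
    refine (intervalIntegral.integral_eq_sub_of_hasDerivAt (f := fun τ => F (x, τ))
      (fun τ _ => hasDerivAt_time hF x τ) ?_).symm
    exact (ct.comp (by fun_prop : Continuous fun τ : ℝ => (x, τ))).intervalIntegrable _ _
  have e2 : ∫ p in Ω ×ˢ Ioc s t, fderiv ℝ F p (H p.2, 1) =
      (∫ p in Ω ×ˢ Ioc s t, fderiv ℝ F p (0, 1)) +
        ∫ p in Ω ×ˢ Ioc s t, fderiv ℝ F p (H p.2, 0) := by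
    rw [← integral_add (hint ct) (hint cx)]
    congr 1
    ext p
    rw [← map_add]
    simp
  have e3 : ∫ p in Ω ×ˢ Ioc s t, fderiv ℝ F p (H p.2, 0) =
      ∑ i, ∫ p in Ω ×ˢ Ioc s t, H p.2 i * fderiv ℝ F p (unitVec i, 0) := by
    rw [← integral_finsetSum _ fun i _ => hint (by have := ci i; fun_prop)]
    congr 1
    ext p
    exact fderiv_space_eq_sum F p _
  -- The time derivative accounts exactly for the difference of slices. What remains is a sum of `d`
  -- coordinate fluxes, hence the factor `d`.
  rw [e1, e2, sub_add_cancel_left, enorm_neg, e3]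
  refine (enorm_sum_le _ _).trans ((Finset.sum_le_card_nsmul _ _ _ fun i _ =>
    enorm_integral_coord_flux_le hΩ hb (a := fun τ => H τ i) (by fun_prop) (M := M)
      (fun τ hτ => ?_) hF i hs hst ht).trans_eq ?_)
  · exact (PiLp.norm_apply_le (H τ) i).trans (hHM τ hτ)
  · simp

/-! ### Weighted energy and observability for smooth functions -/

/-- The weight `|x - x₀|² - δ t²`. -/
def weight (x₀ : E d) (δ : ℝ) (p : E d × ℝ) : ℝ := ‖p.1 - x₀‖ ^ 2 - δ * p.2 ^ 2

lemma contDiff_weight (x₀ : E d) (δ : ℝ) : ContDiff ℝ 1 (weight x₀ δ) := by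
  unfold weight
  exact ((contDiff_fst.sub contDiff_const).norm_sq ℝ).sub (contDiff_const.mul (contDiff_snd.pow 2))

/-- The first term carries the residual of `v`; the last is `v²` times the growth of the weight
along the flow, nonnegative once `δt ≤ H(t)·(x - x₀)`. -/
lemma fderiv_sq_mul_weight (x₀ : E d) (δ : ℝ) {v : E d × ℝ → ℝ} (hv : ContDiff ℝ 1 v)
    (p : E d × ℝ) (w : E d) :
    fderiv ℝ (fun p => v p ^ 2 * weight x₀ δ p) p (w, 1) =
      2 * (v p * fderiv ℝ v p (w, 1)) * weight x₀ δ p +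
        v p ^ 2 * (2 * (inner ℝ w (p.1 - x₀) - δ * p.2)) := by
  have h1 : HasFDerivAt v (fderiv ℝ v p) p := (hv.differentiable (by simp) p).hasFDerivAt
  have h2 : HasFDerivAt (weight x₀ δ) _ p :=
    ((hasFDerivAt_fst (𝕜 := ℝ) (E := E d) (F := ℝ) (p := p)).sub_const x₀).norm_sq.sub
      ((hasFDerivAt_snd.pow 2).const_mul δ)
  have h3 : fderiv ℝ (fun p => v p ^ 2 * weight x₀ δ p) p = _ := ((h1.pow 2).mul h2).fderiv
  rw [h3]
  simp [inner_sub_right, real_inner_comm]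
  ring

lemma fderiv_sq {v : E d × ℝ → ℝ} (hv : ContDiff ℝ 1 v) (p q : E d × ℝ) :
    fderiv ℝ (fun p => v p ^ 2) p q = 2 * (v p * fderiv ℝ v p q) := by
  have h1 : HasFDerivAt v (fderiv ℝ v p) p := (hv.differentiable (by simp) p).hasFDerivAt
  rw [(h1.pow 2).fderiv]
  simp
  ring

lemma abs_le_of_enorm_le {a k n : ℝ} {L : ENNReal} {m : ℕ} (hk : 0 ≤ k)
    (hL : L ≤ ENNReal.ofReal n) (hn : 0 ≤ n)
    (h : ‖a‖ₑ ≤ m * (4 * (ENNReal.ofReal k * L))) : |a| ≤ m * (4 * k) * n := by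
  have h1 : ‖a‖ₑ ≤ ENNReal.ofReal (m * (4 * k) * n) := by
    refine h.trans ?_
    rw [ENNReal.ofReal_mul (by positivity), ENNReal.ofReal_mul (by positivity),
      ENNReal.ofReal_mul (by norm_num : (0 : ℝ) ≤ 4), ENNReal.ofReal_natCast,
      show ENNReal.ofReal 4 = 4 by norm_num]
    calc _ ≤ (m : ENNReal) * (4 * (ENNReal.ofReal k * ENNReal.ofReal n)) := by gcongr
      _ = _ := by ring
  rw [Real.enorm_eq_ofReal_abs] at h1
  exact (ENNReal.ofReal_le_ofReal_iff (by positivity)).1 h1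

/-- The observability inequality for functions smooth up to the boundary, with a remainder
accounting for the failure of the transport equation. -/
theorem exists_integral_sq_le {Ω : Set (E d)} (hΩ : IsOpen Ω) (hb : Bornology.IsBounded Ω)
    {T : ℝ} {H : ℝ → E d} (hH : Continuous H) {x₀ : E d} {δ m M t₁ : ℝ}
    (ht₁ : t₁ ∈ Icc 0 T) (hm : ∀ x ∈ Ω, m ≤ ‖x - x₀‖ ^ 2) (hM : ∀ x ∈ Ω, ‖x - x₀‖ ^ 2 ≤ M)
    (hδ : ∀ x ∈ Ω, ∀ t ∈ Icc 0 t₁, δ * t ≤ inner ℝ (H t) (x - x₀))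
    (hlt : M - m < δ * t₁ ^ 2) :
    ∃ C : ℝ, 0 < C ∧ ∀ v : E d × ℝ → ℝ, ContDiff ℝ 1 v → ∀ t ∈ Icc 0 T,
      ENNReal.ofReal (∫ x in Ω, v (x, t) ^ 2) ≤ ENNReal.ofReal C *
        (ENNReal.ofReal (∫ p in Ω ×ˢ Ioc 0 T, |v p * fderiv ℝ v p (H p.2, 1)|) +
          ∫⁻ p, ‖v p‖ₑ ^ 2 ∂(lateralMeasure Ω T)) := by
  obtain ⟨k', hk'⟩ := (isCompact_Icc (a := (0 : ℝ)) (b := T)).exists_bound_of_continuousOn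
    hH.continuousOn
  obtain ⟨k, hk0, hk⟩ : ∃ k : ℝ, 0 ≤ k ∧ ∀ t ∈ Icc 0 T, ‖H t‖ ≤ k :=
    ⟨|k'|, abs_nonneg _, fun t ht => (hk' t ht).trans (le_abs_self _)⟩
  have hψ := contDiff_weight x₀ δ
  have hψc := hψ.continuous
  obtain ⟨B', hB'⟩ := (hb.isCompact_closure.prod (isCompact_Icc (a := (0 : ℝ))
    (b := T))).exists_bound_of_continuousOn hψc.continuousOn
  obtain ⟨B, hB0, hB⟩ : ∃ B : ℝ, 0 ≤ B ∧ ∀ x ∈ closure Ω, ∀ t ∈ Icc 0 T,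
      |weight x₀ δ (x, t)| ≤ B :=
    ⟨|B'|, abs_nonneg _, fun x hx t ht => (hB' (x, t) ⟨hx, ht⟩).trans (le_abs_self _)⟩
  set K : ℝ := d * (4 * k)
  have hK0 : 0 ≤ K := by positivity
  -- `q` bounds the weight from above at time `t₁`, and `m` bounds it from below at time `0`; `hlt`
  -- is exactly the gap `q < m`.
  set q := M - δ * t₁ ^ 2
  have hω : 0 < m - q := by simp only [q]; linarith
  -- The quotient bounds `A 0`; the extra `1` pays for passing from `A 0` to `A t`.
  set D := (|q| + B) / (m - q) + 1
  have hD : 0 < D := by positivity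
  refine ⟨D * (2 + K), by positivity, fun v hv t ht => ?_⟩
  have hvc := hv.continuous
  set L := ∫⁻ p, ‖v p‖ₑ ^ 2 ∂(lateralMeasure Ω T) with hL
  rcases eq_or_ne L ⊤ with htop | hfin
  · rw [htop, add_top, ENNReal.mul_top (by simp; positivity)]
    exact le_top
  set N := L.toReal with hN
  have hN0 : 0 ≤ N := ENNReal.toReal_nonneg
  have hLN : L = ENNReal.ofReal N := (ENNReal.ofReal_toReal hfin).symm
  have hr : Continuous fun p : E d × ℝ => fderiv ℝ v p (H p.2, 1) :=
    (hv.continuous_fderiv (by simp)).clm_apply (by fun_prop)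
  set e := ∫ p in Ω ×ˢ Ioc 0 T, |v p * fderiv ℝ v p (H p.2, 1)| with he
  have he0 : 0 ≤ e := integral_nonneg fun p => abs_nonneg _
  have hint : ∀ {f : E d × ℝ → ℝ} (s t : ℝ), Continuous f → IntegrableOn f (Ω ×ˢ Ioc s t) := by
    intro f s t hf
    have := integrable_prod_of_continuous hb s t hf
    rwa [Measure.prod_restrict] at this
  have hintx : ∀ {f : E d → ℝ}, Continuous f → IntegrableOn f Ω := fun hf =>
    (hf.continuousOn.integrableOn_compact hb.isCompact_closure).mono_set subset_closure
  have hmeas : ∀ t : ℝ, MeasurableSet (Ω ×ˢ Ioc (0 : ℝ) t) := fun t =>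
    hΩ.measurableSet.prod measurableSet_Ioc
  have hemono : ∀ t ≤ T, ∫ p in Ω ×ˢ Ioc 0 t, |v p * fderiv ℝ v p (H p.2, 1)| ≤ e := fun t ht =>
    setIntegral_mono_set (hint 0 T (by fun_prop)) (ae_of_all _ fun p => abs_nonneg _)
      (Eventually.of_forall (prod_mono subset_rfl (Ioc_subset_Ioc_right ht)))
  set A : ℝ → ℝ := fun t => ∫ x in Ω, v (x, t) ^ 2 with hA
  have hA0 : ∀ t, 0 ≤ A t := fun t => integral_nonneg fun x => sq_nonneg _
  have henergy : ∀ t ∈ Icc 0 T, |A t - A 0| ≤ 2 * e + K * N := by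
    intro t ht
    have h1 := abs_le_of_enorm_le hk0 (n := N) (by simp [← hLN, hL]) hN0
      (enorm_balance_le hΩ hb hH hk (hv.pow 2) le_rfl ht.1 ht.2)
    simp only [fderiv_sq hv, integral_const_mul] at h1
    have h2 := (abs_integral_le_integral_abs (f := fun p => v p * fderiv ℝ v p (H p.2, 1))
      (μ := volume.restrict (Ω ×ˢ Ioc 0 t))).trans (hemono t ht.2)
    rw [abs_le] at h1 h2 ⊢
    constructor <;> simp only [hA] <;> linarith [h1.1, h1.2, h2.1, h2.2]
  -- Near-monotonicity of `∫ v²ψ`: the weight's growth is dropped as nonnegative, and the losses are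
  -- the residual and the lateral flux, each with `|ψ| ≤ B`.
  have hP : -(2 * B * e + K * B * N) ≤ (∫ x in Ω, v (x, t₁) ^ 2 * weight x₀ δ (x, t₁)) -
      ∫ x in Ω, v (x, 0) ^ 2 * weight x₀ δ (x, 0) := by
    have hlat : ∫⁻ p, ‖v p ^ 2 * weight x₀ δ p‖ₑ ∂(lateralMeasure Ω T) ≤
        ENNReal.ofReal (B * N) := by
      rw [ENNReal.ofReal_mul hB0, ← hLN, hL, lintegral_lateralMeasure Ω T (by fun_prop),
        lintegral_lateralMeasure Ω T (by fun_prop),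
        ← lintegral_const_mul' _ _ ENNReal.ofReal_ne_top]
      refine lintegral_mono_ae ?_
      filter_upwards [ae_restrict_mem isClosed_frontier.measurableSet] with x hx
      rw [← lintegral_const_mul' _ _ ENNReal.ofReal_ne_top]
      refine setLIntegral_mono (((by fun_prop : Continuous fun τ => v (x, τ)).measurable.enorm.pow_const
        2).const_mul _) fun τ hτ => ?_
      rw [enorm_mul, enorm_pow, mul_comm, Real.enorm_eq_ofReal_abs (weight _ _ _)]
      gcongr
      exact hB x (frontier_subset_closure hx) τ (Ioo_subset_Icc_self hτ)
    have h1 := abs_le_of_enorm_le hk0 hlat (by positivity)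
      (enorm_balance_le hΩ hb hH hk ((hv.pow 2).mul hψ) le_rfl ht₁.1 ht₁.2)
    have h2 : -(2 * B * e) ≤
        ∫ p in Ω ×ˢ Ioc 0 t₁, fderiv ℝ (fun p => v p ^ 2 * weight x₀ δ p) p (H p.2, 1) := by
      have h3 : ∫ p in Ω ×ˢ Ioc 0 t₁, -(2 * B) * |v p * fderiv ℝ v p (H p.2, 1)| ≤
          ∫ p in Ω ×ˢ Ioc 0 t₁, fderiv ℝ (fun p => v p ^ 2 * weight x₀ δ p) p (H p.2, 1) := by
        simp only [fderiv_sq_mul_weight x₀ δ hv]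
        refine setIntegral_mono_on (hint _ _ (by fun_prop)) (hint _ _ (by fun_prop)) (hmeas t₁)
          fun p hp => ?_
        have hpT : p.2 ∈ Icc 0 T := ⟨hp.2.1.le, hp.2.2.trans ht₁.2⟩
        have b1 := hB p.1 (subset_closure hp.1) p.2 hpT
        have b2 := hδ p.1 hp.1 p.2 ⟨hp.2.1.le, hp.2.2⟩
        have b3 : 0 ≤ v p ^ 2 * (2 * (inner ℝ (H p.2) (p.1 - x₀) - δ * p.2)) :=
          mul_nonneg (sq_nonneg _) (by linarith)
        have b4 : |v p * fderiv ℝ v p (H p.2, 1) * weight x₀ δ p| ≤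
            |v p * fderiv ℝ v p (H p.2, 1)| * B := by
          rw [abs_mul]
          gcongr
        have b5 := neg_abs_le (v p * fderiv ℝ v p (H p.2, 1) * weight x₀ δ p)
        linarith
      rw [integral_const_mul] at h3
      have h4 := mul_le_mul_of_nonneg_left (hemono t₁ ht₁.2) (by positivity : 0 ≤ 2 * B)
      linarith
    rw [abs_le] at h1
    have h5 := h1.1
    change -(K * (B * N)) ≤ _ - ∫ p in Ω ×ˢ Ioc 0 t₁,
      fderiv ℝ (fun p => v p ^ 2 * weight x₀ δ p) p (H p.2, 1) at h5
    linarith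
  have hP1 : ∫ x in Ω, v (x, t₁) ^ 2 * weight x₀ δ (x, t₁) ≤ q * A t₁ := by
    rw [hA, ← integral_const_mul]
    refine setIntegral_mono_on (hintx (by fun_prop)) (hintx (by fun_prop)) hΩ.measurableSet
      fun x hx => ?_
    rw [mul_comm]
    refine mul_le_mul_of_nonneg_right ?_ (sq_nonneg _)
    simp only [weight, q]
    linarith [hM x hx]
  have hP0 : m * A 0 ≤ ∫ x in Ω, v (x, 0) ^ 2 * weight x₀ δ (x, 0) := by
    rw [hA, ← integral_const_mul]
    refine setIntegral_mono_on (hintx (by fun_prop)) (hintx (by fun_prop)) hΩ.measurableSet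
      fun x hx => ?_
    rw [mul_comm]
    refine mul_le_mul_of_nonneg_left ?_ (sq_nonneg _)
    simp only [weight]
    linarith [hm x hx]
  have hq : q * (A t₁ - A 0) ≤ |q| * (2 * e + K * N) :=
    (le_abs_self _).trans ((abs_mul _ _).trans_le
      (mul_le_mul_of_nonneg_left (henergy t₁ ht₁) (abs_nonneg _)))
  have hfinal : A t ≤ D * (2 * e + K * N) := by
    -- Combine `hP`, `hP1` and `hP0`, writing `q * A t₁` as `q * A 0 + q * (A t₁ - A 0)`; `hq`
    -- handles either sign of `q`.
    have h1 : (m - q) * A 0 ≤ (|q| + B) * (2 * e + K * N) := by linarith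
    have h2 : A 0 ≤ (|q| + B) / (m - q) * (2 * e + K * N) := by
      rw [div_mul_eq_mul_div, le_div_iff₀ hω]
      linarith
    have h3 := (abs_le.1 (henergy t ht)).2
    simp only [D]
    linarith
  rw [hLN, ← ENNReal.ofReal_add he0 hN0, ← ENNReal.ofReal_mul (by positivity)]
  refine ENNReal.ofReal_le_ofReal (hfinal.trans ?_)
  calc D * (2 * e + K * N) ≤ D * ((2 + K) * (e + N)) := by
        refine mul_le_mul_of_nonneg_left ?_ hD.le
        nlinarith [mul_nonneg hK0 he0]
    _ = _ := by ring

/-! ### Residuals and time slices in `L²` -/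

/-- The residual `∂ₜv + H(t)·∇v` of the transport equation. -/
def residual (H : ℝ → E d) (v : E d × ℝ → ℝ) (p : E d × ℝ) : ℝ :=
  timeDeriv v p + inner ℝ (H p.2) (spaceGrad v p)

lemma spaceGrad_eq {v : E d × ℝ → ℝ} (hv : ContDiff ℝ 1 v) (p : E d × ℝ) :
    spaceGrad v p = (InnerProductSpace.toDual ℝ (E d)).symm
      ((fderiv ℝ v p).comp (ContinuousLinearMap.inl ℝ (E d) ℝ)) := by
  have h : HasFDerivAt (fun x => v (x, p.2))
      ((fderiv ℝ v p).comp (ContinuousLinearMap.inl ℝ (E d) ℝ)) p.1 :=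
    (hv.differentiable (by simp) (p.1, p.2)).hasFDerivAt.comp p.1 (hasFDerivAt_prodMk_left p.1 p.2)
  rw [spaceGrad, gradient, h.fderiv]

lemma continuous_timeDeriv {v : E d × ℝ → ℝ} (hv : ContDiff ℝ 1 v) : Continuous (timeDeriv v) :=
  (hv.continuous_fderiv (by simp)).clm_apply continuous_const

lemma continuous_spaceGrad {v : E d × ℝ → ℝ} (hv : ContDiff ℝ 1 v) : Continuous (spaceGrad v) := by
  rw [show spaceGrad v = _ from funext (spaceGrad_eq hv)]
  exact (LinearIsometryEquiv.continuous _).comp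
    ((hv.continuous_fderiv (by simp)).clm_comp continuous_const)

lemma residual_eq_fderiv (H : ℝ → E d) {v : E d × ℝ → ℝ} (hv : ContDiff ℝ 1 v) (p : E d × ℝ) :
    residual H v p = fderiv ℝ v p (H p.2, 1) := by
  rw [residual, timeDeriv, spaceGrad_eq hv, real_inner_comm, InnerProductSpace.toDual_symm_apply,
    ContinuousLinearMap.comp_apply, ContinuousLinearMap.inl_apply, ← map_add]
  simp

lemma continuous_residual {H : ℝ → E d} (hH : Continuous H) {v : E d × ℝ → ℝ}
    (hv : ContDiff ℝ 1 v) : Continuous (residual H v) := by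
  have h1 := continuous_timeDeriv hv
  have h2 := continuous_spaceGrad hv
  unfold residual
  fun_prop

lemma residual_sub (H : ℝ → E d) {v w : E d × ℝ → ℝ} (hv : ContDiff ℝ 1 v) (hw : ContDiff ℝ 1 w) :
    residual H (v - w) = residual H v - residual H w := by
  ext p
  have hvw : ContDiff ℝ 1 (v - w) := hv.sub hw
  rw [Pi.sub_apply, residual_eq_fderiv H hv, residual_eq_fderiv H hw,
    residual_eq_fderiv H hvw,
    fderiv_sub (hv.differentiable (by simp) p) (hw.differentiable (by simp) p)]
  rfl

lemma eLpNorm_two_sq {α F : Type*} [MeasurableSpace α] [NormedAddCommGroup F] (f : α → F)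
    (μ : Measure α) : eLpNorm f 2 μ ^ 2 = ∫⁻ x, ‖f x‖ₑ ^ 2 ∂μ := by
  have h := eLpNorm_nnreal_pow_eq_lintegral (f := f) (μ := μ) (p := 2) (by norm_num)
  simpa using h

lemma memLp_slice {Ω : Set (E d)} (hb : Bornology.IsBounded Ω) {v : E d × ℝ → ℝ}
    (hv : Continuous v) (t : ℝ) : MemLp (fun x => v (x, t)) 2 (interiorMeasure Ω) := by
  have hc : Continuous fun x => v (x, t) := by fun_prop
  obtain ⟨C, hC⟩ := hb.isCompact_closure.exists_bound_of_continuousOn hc.continuousOn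
  have : IsFiniteMeasure (interiorMeasure Ω) := ⟨by
    simpa [interiorMeasure] using hb.measure_lt_top⟩
  have h1 : ∀ᵐ x ∂(volume.restrict (closure Ω)), ‖v (x, t)‖ ≤ C :=
    (ae_restrict_iff' isClosed_closure.measurableSet).2 (ae_of_all _ hC)
  exact MemLp.of_bound hc.aestronglyMeasurable C (ae_restrict_of_ae_restrict_of_subset
    subset_closure h1)

/-- The time slice `v(·, t)` of a continuous function as an element of `L²(Ω)`. -/
def slice {Ω : Set (E d)} (hb : Bornology.IsBounded Ω) {v : E d × ℝ → ℝ} (hv : Continuous v)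
    (t : ℝ) : Lp ℝ 2 (interiorMeasure Ω) := (memLp_slice hb hv t).toLp

/-- Uniform continuity on the compact closed cylinder gives sup-norm continuity in time, and finite
volume turns this into `L²` continuity. -/
lemma continuousOn_slice {Ω : Set (E d)} (hb : Bornology.IsBounded Ω) {v : E d × ℝ → ℝ}
    (hv : Continuous v) (T : ℝ) : ContinuousOn (slice hb hv) (Icc 0 T) := by
  set V : ENNReal := interiorMeasure Ω univ ^ (2 : ENNReal).toReal⁻¹
  have hV : V ≠ ⊤ := by
    refine ENNReal.rpow_ne_top_of_nonneg (by positivity) ?_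
    simpa [interiorMeasure] using hb.measure_lt_top.ne
  have huc := (hb.isCompact_closure.prod (isCompact_Icc (a := (0 : ℝ))
    (b := T))).uniformContinuousOn_of_continuous hv.continuousOn
  rw [Metric.uniformContinuousOn_iff] at huc
  rw [Metric.continuousOn_iff]
  intro t ht ε hε
  set η := ε / (2 * (V.toReal + 1))
  have hη : 0 < η := by positivity
  obtain ⟨δ, hδ, h⟩ := huc η hη
  refine ⟨δ, hδ, fun s hs hst => ?_⟩
  have hae : ∀ᵐ x ∂(interiorMeasure Ω), ‖((fun x => v (x, s)) - fun x => v (x, t)) x‖ ≤ η := by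
    refine ae_restrict_of_ae_restrict_of_subset subset_closure
      ((ae_restrict_iff' isClosed_closure.measurableSet).2 (ae_of_all _ fun x hx => ?_))
    have := h (x, s) ⟨hx, hs⟩ (x, t) ⟨hx, ht⟩ (by simpa [Prod.dist_eq, hδ] using hst)
    exact this.le
  have h1 := eLpNorm_le_of_ae_bound (p := 2) hae
  rw [dist_edist, slice, slice, Lp.edist_toLp_toLp]
  refine (ENNReal.toReal_mono (ENNReal.mul_ne_top hV ENNReal.ofReal_ne_top) h1).trans_lt ?_
  rw [ENNReal.toReal_mul, ENNReal.toReal_ofReal hη.le]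
  have h0 : 0 ≤ V.toReal := ENNReal.toReal_nonneg
  calc V.toReal * η ≤ (V.toReal + 1) * η := by nlinarith
    _ = ε / 2 := by
      simp only [η]
      field_simp
    _ < ε := by linarith

lemma restrict_cylinder (Ω : Set (E d)) (T : ℝ) : volume.restrict (cylinder Ω T) =
    (interiorMeasure Ω).prod (volume.restrict (Ioo 0 T)) := by
  rw [interiorMeasure, Measure.prod_restrict]
  rfl

/-- Cauchy–Schwarz; the time endpoint `T` is null. -/
lemma integral_abs_mul_le_eLpNorm {Ω : Set (E d)} (hb : Bornology.IsBounded Ω) (T : ℝ)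
    {f g : E d × ℝ → ℝ} (hf : Continuous f) (hg : Continuous g) :
    ENNReal.ofReal (∫ p in Ω ×ˢ Ioc 0 T, |f p * g p|) ≤
      eLpNorm f 2 (volume.restrict (cylinder Ω T)) *
        eLpNorm g 2 (volume.restrict (cylinder Ω T)) := by
  have hr : (volume : Measure (E d × ℝ)).restrict (Ω ×ˢ Ioc 0 T) =
      volume.restrict (cylinder Ω T) := by
    rw [restrict_cylinder, interiorMeasure, Measure.volume_eq_prod, ← Measure.prod_restrict]
    rw [Measure.restrict_congr_set (Ioo_ae_eq_Ioc (a := (0 : ℝ)) (b := T) (μ := volume))]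
  have hint : IntegrableOn (fun p => |f p * g p|) (Ω ×ˢ Ioc 0 T) := by
    have := integrable_prod_of_continuous hb 0 T (hf.mul hg).abs
    rwa [Measure.prod_restrict] at this
  rw [ofReal_integral_eq_lintegral_ofReal hint (ae_of_all _ fun p => abs_nonneg _), ← hr]
  have h := eLpNorm_smul_le_mul_eLpNorm (p := 2) (q := 2) (r := 1)
    (μ := volume.restrict (Ω ×ˢ Ioc 0 T)) hg.aestronglyMeasurable hf.aestronglyMeasurable
  rw [eLpNorm_one_eq_lintegral_enorm] at h
  simpa [Real.enorm_eq_ofReal_abs] using h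

/-- The observability inequality for functions smooth up to the boundary, in terms of norms. -/
theorem exists_eLpNorm_slice_sq_le {Ω : Set (E d)} (hΩ : IsOpen Ω) (hb : Bornology.IsBounded Ω)
    {T : ℝ} {H : ℝ → E d} (hH : Continuous H) {x₀ : E d} {δ m M t₁ : ℝ}
    (ht₁ : t₁ ∈ Icc 0 T) (hm : ∀ x ∈ Ω, m ≤ ‖x - x₀‖ ^ 2) (hM : ∀ x ∈ Ω, ‖x - x₀‖ ^ 2 ≤ M)
    (hδ : ∀ x ∈ Ω, ∀ t ∈ Icc 0 t₁, δ * t ≤ inner ℝ (H t) (x - x₀))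
    (hlt : M - m < δ * t₁ ^ 2) :
    ∃ C : ℝ, 0 < C ∧ ∀ v : E d × ℝ → ℝ, ContDiff ℝ 1 v → ∀ t ∈ Icc 0 T,
      eLpNorm (fun x => v (x, t)) 2 (interiorMeasure Ω) ^ 2 ≤ ENNReal.ofReal C *
        (eLpNorm v 2 (volume.restrict (cylinder Ω T)) *
            eLpNorm (residual H v) 2 (volume.restrict (cylinder Ω T)) +
          eLpNorm v 2 (lateralMeasure Ω T) ^ 2) := by
  obtain ⟨C, hC, h⟩ := exists_integral_sq_le hΩ hb hH ht₁ hm hM hδ hlt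
  refine ⟨C, hC, fun v hv t ht => ?_⟩
  have hvc := hv.continuous
  have e1 : eLpNorm (fun x => v (x, t)) 2 (interiorMeasure Ω) ^ 2 =
      ENNReal.ofReal (∫ x in Ω, v (x, t) ^ 2) := by
    rw [eLpNorm_two_sq, ofReal_integral_eq_lintegral_ofReal]
    · simp [interiorMeasure, Real.enorm_eq_ofReal_abs, ← ENNReal.ofReal_pow]
    · exact (memLp_slice hb hvc t).integrable_sq
    · exact ae_of_all _ fun x => sq_nonneg _
  have e2 : (fun p => fderiv ℝ v p (H p.2, 1)) = residual H v :=
    funext fun p => (residual_eq_fderiv H hv p).symm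
  have h1 := h v hv t ht
  simp only [congrFun e2] at h1
  rw [e1, eLpNorm_two_sq]
  refine h1.trans ?_
  gcongr
  exact integral_abs_mul_le_eLpNorm hb T hvc (continuous_residual hH hv)

/-! ### Passage to the limit in `H¹` -/

lemma eLpNorm_sub_le_of_center {α F : Type*} [MeasurableSpace α] [NormedAddCommGroup F]
    {μ : Measure α} {f g c : α → F} (hf : AEStronglyMeasurable f μ)
    (hg : AEStronglyMeasurable g μ) (hc : AEStronglyMeasurable c μ) :
    eLpNorm (f - g) 2 μ ≤ eLpNorm (f - c) 2 μ + eLpNorm (g - c) 2 μ := by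
  have h := eLpNorm_sub_le (p := 2) (hf.sub hc) (hg.sub hc) (by norm_num)
  rwa [sub_sub_sub_cancel_right] at h

/-- The residuals of smooth functions converging in `H¹` to a solution tend to zero. -/
lemma tendsto_eLpNorm_residual {Q : Measure (E d × ℝ)} {H : ℝ → E d} (hH : Continuous H) {k : ℝ}
    (hk : ∀ᵐ p ∂Q, ‖H p.2‖ ≤ k) {v : ℕ → E d × ℝ → ℝ} (hv : ∀ n, ContDiff ℝ 1 (v n))
    {ut : E d × ℝ → ℝ} {ux : E d × ℝ → E d} (hut : AEStronglyMeasurable ut Q)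
    (hux : AEStronglyMeasurable ux Q) (heq : ∀ᵐ p ∂Q, ut p + inner ℝ (H p.2) (ux p) = 0)
    (ht : Tendsto (fun n => eLpNorm (fun p => timeDeriv (v n) p - ut p) 2 Q) atTop (𝓝 0))
    (hx : Tendsto (fun n => eLpNorm (fun p => spaceGrad (v n) p - ux p) 2 Q) atTop (𝓝 0)) :
    Tendsto (fun n => eLpNorm (residual H (v n)) 2 Q) atTop (𝓝 0) := by
  have h0 := ht.add (ENNReal.Tendsto.const_mul hx (Or.inr (ENNReal.ofReal_ne_top (r := k))))
  rw [mul_zero, add_zero] at h0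
  refine tendsto_of_tendsto_of_tendsto_of_le_of_le tendsto_const_nhds h0 (fun _ => zero_le)
    fun n => ?_
  have m1 : AEStronglyMeasurable (fun p => timeDeriv (v n) p - ut p) Q :=
    (continuous_timeDeriv (hv n)).aestronglyMeasurable.sub hut
  have m2 : AEStronglyMeasurable (fun p => spaceGrad (v n) p - ux p) Q :=
    (continuous_spaceGrad (hv n)).aestronglyMeasurable.sub hux
  have m3 : AEStronglyMeasurable (fun p => inner ℝ (H p.2) (spaceGrad (v n) p - ux p)) Q :=
    (hH.comp continuous_snd).aestronglyMeasurable.inner m2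
  -- Subtracting the equation for the limit expresses the residual through the approximation errors
  -- of the derivatives.
  have e1 : residual H (v n) =ᵐ[Q] (fun p => timeDeriv (v n) p - ut p) +
      fun p => inner ℝ (H p.2) (spaceGrad (v n) p - ux p) := by
    filter_upwards [heq] with p hp
    simp only [residual, Pi.add_apply, inner_sub_right]
    linarith
  rw [eLpNorm_congr_ae e1]
  refine (eLpNorm_add_le m1 m3 (by norm_num)).trans (add_le_add le_rfl ?_)
  refine eLpNorm_le_mul_eLpNorm_of_ae_le_mul ?_ 2
  filter_upwards [hk] with p hp
  exact (norm_inner_le_norm _ _).trans (mul_le_mul_of_nonneg_right hp (norm_nonneg _))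

/-- If continuous functions converge to `u` in `L²(Q)` and their time slices converge uniformly
to `U`, then `U` consists of the time slices of `u`. -/
lemma slice_ae_eq_of_tendsto {Ω : Set (E d)} (hb : Bornology.IsBounded Ω) {T : ℝ}
    {v : ℕ → E d × ℝ → ℝ} (hv : ∀ n, Continuous (v n)) {u : E d × ℝ → ℝ}
    (hu : AEStronglyMeasurable u (volume.restrict (cylinder Ω T)))
    (hvu : Tendsto (fun n => eLpNorm (fun p => v n p - u p) 2 (volume.restrict (cylinder Ω T)))
      atTop (𝓝 0))
    {U : ℝ → Lp ℝ 2 (interiorMeasure Ω)}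
    (hU : ∀ t ∈ Icc 0 T, Tendsto (fun n => slice hb (hv n) t) atTop (𝓝 (U t))) :
    ∀ᵐ t ∂(volume.restrict (Ioo 0 T)), U t =ᵐ[interiorMeasure Ω] fun x => u (x, t) := by
  have hsf : SFinite (interiorMeasure Ω) := by unfold interiorMeasure; infer_instance
  rw [restrict_cylinder] at hu hvu
  have hsm : ∀ᵐ t ∂(volume.restrict (Ioo 0 T)),
      AEStronglyMeasurable (fun x => u (x, t)) (interiorMeasure Ω) :=
    hu.prod_swap.prodMk_left
  set φ : ℕ → ℝ → ENNReal := fun n t => eLpNorm (fun x => v n (x, t) - u (x, t)) 2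
    (interiorMeasure Ω) ^ 2 with hφ
  have hm : ∀ n, AEMeasurable (fun p => ‖v n p - u p‖ₑ ^ 2)
      ((interiorMeasure Ω).prod (volume.restrict (Ioo 0 T))) := fun n =>
    ((hv n).aestronglyMeasurable.sub hu).enorm.pow_const 2
  have hφe : ∀ n, φ n = fun t => ∫⁻ x, ‖v n (x, t) - u (x, t)‖ₑ ^ 2 ∂(interiorMeasure Ω) :=
    fun n => funext fun t => eLpNorm_two_sq _ _
  have hφm : ∀ n, AEMeasurable (φ n) (volume.restrict (Ioo 0 T)) := fun n => by
    rw [hφe n]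
    exact (hm n).lintegral_prod_left'
  have hφint : Tendsto (fun n => ∫⁻ t in Ioo 0 T, φ n t) atTop (𝓝 0) := by
    have h2 := ENNReal.Tendsto.pow (n := 2) hvu
    rw [zero_pow two_ne_zero] at h2
    refine h2.congr fun n => ?_
    rw [eLpNorm_two_sq, lintegral_prod_symm _ (hm n)]
    simp only [hφe]
  -- Fatou's lemma replaces extraction of an a.e. convergent subsequence: `φ n t` is small for
  -- infinitely many `n`, which suffices because the slices are close to `U t` for all large `n`.
  have hlim : ∀ᵐ t ∂(volume.restrict (Ioo 0 T)), liminf (fun n => φ n t) atTop = 0 := by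
    have h1 := lintegral_liminf_le' (u := atTop) hφm
    have h2 : AEMeasurable (fun t => liminf (fun n => φ n t) atTop) (volume.restrict (Ioo 0 T)) := by
      simp only [liminf_eq_iSup_iInf_of_nat]
      exact AEMeasurable.iSup fun n => AEMeasurable.biInf _ (to_countable {i | i ≥ n})
        fun i _ => hφm i
    rw [hφint.liminf_eq, nonpos_iff_eq_zero, lintegral_eq_zero_iff' h2] at h1
    exact h1
  filter_upwards [hlim, hsm, ae_restrict_mem measurableSet_Ioo] with t htl htm htT
  have hzero : eLpNorm ((U t : E d → ℝ) - fun x => u (x, t)) 2 (interiorMeasure Ω) = 0 := by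
    refine nonpos_iff_eq_zero.1 (le_of_forall_pos_le_add fun ε hε => ?_)
    rw [zero_add]
    rcases eq_or_ne ε ⊤ with rfl | hεtop
    · exact le_top
    have hε2 : 0 < ε / 2 := ENNReal.half_pos hε.ne'
    have hfr : ∃ᶠ n in atTop, φ n t < (ε / 2) ^ 2 :=
      frequently_lt_of_liminf_lt (by isBoundedDefault)
        (by rw [htl]; exact ENNReal.pow_pos hε2 2)
    have hev : ∀ᶠ n in atTop, edist (slice hb (hv n) t) (U t) < ε / 2 :=
      (tendsto_iff_edist_tendsto_0.1 (hU t (Ioo_subset_Icc_self htT))).eventually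
        (gt_mem_nhds hε2)
    obtain ⟨n, hn1, hn2⟩ := (hfr.and_eventually hev).exists
    have hn1' : eLpNorm (fun x => v n (x, t) - u (x, t)) 2 (interiorMeasure Ω) < ε / 2 :=
      lt_of_pow_lt_pow_left' 2 hn1
    rw [edist_comm, Lp.edist_def] at hn2
    have hsl : slice hb (hv n) t =ᵐ[interiorMeasure Ω] fun x => v n (x, t) :=
      MemLp.coeFn_toLp _
    have hn2' : eLpNorm ((U t : E d → ℝ) - fun x => v n (x, t)) 2 (interiorMeasure Ω) < ε / 2 := by
      rwa [← eLpNorm_congr_ae ((ae_eq_refl (U t : E d → ℝ)).sub hsl)]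
    have hadd := eLpNorm_add_le (p := 2) ((Lp.aestronglyMeasurable (U t)).sub
      (memLp_slice hb (hv n) t).1) ((memLp_slice hb (hv n) t).1.sub htm) (by norm_num)
    rw [sub_add_sub_cancel] at hadd
    calc _ ≤ _ := hadd
      _ ≤ ε / 2 + ε / 2 := add_le_add hn2'.le hn1'.le
      _ = ε := ENNReal.add_halves ε
  rw [eLpNorm_eq_zero_iff ((Lp.aestronglyMeasurable (U t)).sub htm) (by norm_num)] at hzero
  filter_upwards [hzero] with x hx
  exact sub_eq_zero.1 hx

/-- The observability inequality passes from smooth functions to solutions in `H¹(Q)`. -/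
theorem exists_isTimeSlice {Ω : Set (E d)} (hb : Bornology.IsBounded Ω) {T : ℝ} {H : ℝ → E d}
    (hH : Continuous H) {C : ℝ}
    (hobs : ∀ v : E d × ℝ → ℝ, ContDiff ℝ 1 v → ∀ t ∈ Icc 0 T,
      eLpNorm (fun x => v (x, t)) 2 (interiorMeasure Ω) ^ 2 ≤ ENNReal.ofReal C *
        (eLpNorm v 2 (volume.restrict (cylinder Ω T)) *
            eLpNorm (residual H v) 2 (volume.restrict (cylinder Ω T)) +
          eLpNorm v 2 (lateralMeasure Ω T) ^ 2))
    {g : Lp ℝ 2 (lateralMeasure Ω T)} {u : H1 (cylinder Ω T)} (hu : IsSolution Ω T H g u) :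
    ∃ U : ℝ → Lp ℝ 2 (interiorMeasure Ω), IsTimeSlice Ω T u U ∧
      ∀ t ∈ Icc 0 T, ‖U t‖ₑ ^ 2 ≤ ENNReal.ofReal C * ‖g‖ₑ ^ 2 := by
  obtain ⟨v, hvs, hα, hαt, hαx, hγ⟩ := hu.boundary
  have hv : ∀ n, ContDiff ℝ 1 (v n) := fun n => (hvs n).of_le (by exact_mod_cast le_top)
  have hvc : ∀ n, Continuous (v n) := fun n => (hv n).continuous
  set Q := (volume : Measure (E d × ℝ)).restrict (cylinder Ω T)
  obtain ⟨k, hk⟩ := (isCompact_Icc (a := (0 : ℝ)) (b := T)).exists_bound_of_continuousOn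
    hH.continuousOn
  have hkQ : ∀ᵐ p ∂Q, ‖H p.2‖ ≤ k := by
    rw [show Q = _ from restrict_cylinder Ω T]
    have h1 : ∀ᵐ t ∂(volume.restrict (Ioo 0 T)), ‖H t‖ ≤ k :=
      (ae_restrict_iff' measurableSet_Ioo).2 (ae_of_all _ fun t ht =>
        hk t (Ioo_subset_Icc_self ht))
    exact Measure.quasiMeasurePreserving_snd.ae h1
  set α : ℕ → ENNReal := fun n => eLpNorm (fun p => v n p - u.val p) 2 Q
  set β : ℕ → ENNReal := fun n => eLpNorm (residual H (v n)) 2 Q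
  set γ : ℕ → ENNReal := fun n => eLpNorm (fun p => v n p - g p) 2 (lateralMeasure Ω T)
  have hβ : Tendsto β atTop (𝓝 0) :=
    tendsto_eLpNorm_residual hH hkQ hv u.memLp_dt.1 u.memLp_grad.1 hu.equation hαt hαx
  -- Observability for `v n - v m`, with each norm compared to its limit; the right side is
  -- independent of `t`, so convergence is uniform.
  have hpair : ∀ n m, ∀ t ∈ Icc 0 T,
      edist (slice hb (hvc n) t) (slice hb (hvc m) t) ^ 2 ≤
        ENNReal.ofReal C * ((α n + α m) * (β n + β m) + (γ n + γ m) ^ 2) := by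
    intro n m t ht
    rw [slice, slice, Lp.edist_toLp_toLp]
    refine (hobs (v n - v m) ((hv n).sub (hv m)) t ht).trans ?_
    rw [residual_sub H (hv n) (hv m)]
    gcongr
    · exact eLpNorm_sub_le_of_center (hvc n).aestronglyMeasurable (hvc m).aestronglyMeasurable
        u.memLp_val.1
    · exact eLpNorm_sub_le (continuous_residual hH (hv n)).aestronglyMeasurable
        (continuous_residual hH (hv m)).aestronglyMeasurable (by norm_num)
    · exact eLpNorm_sub_le_of_center (hvc n).aestronglyMeasurable (hvc m).aestronglyMeasurable
        (Lp.aestronglyMeasurable g)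
  have hpair0 : Tendsto (fun q : ℕ × ℕ => ENNReal.ofReal C *
      ((α q.1 + α q.2) * (β q.1 + β q.2) + (γ q.1 + γ q.2) ^ 2)) atTop (𝓝 0) := by
    have hsum : ∀ {f : ℕ → ENNReal}, Tendsto f atTop (𝓝 0) →
        Tendsto (fun q : ℕ × ℕ => f q.1 + f q.2) atTop (𝓝 0) := fun {f} hf => by
      rw [← prod_atTop_atTop_eq]
      simpa using (hf.comp tendsto_fst).add (hf.comp (tendsto_snd (f := atTop)))
    have h1 := ENNReal.Tendsto.const_mul (a := ENNReal.ofReal C)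
      ((ENNReal.Tendsto.mul (hsum hα) (by simp) (hsum hβ) (by simp)).add
        (ENNReal.Tendsto.pow (n := 2) (hsum hγ))) (Or.inr ENNReal.ofReal_ne_top)
    simpa using h1
  have hcauchy : UniformCauchySeqOn (fun n t => slice hb (hvc n) t) atTop (Icc 0 T) := by
    rw [Metric.uniformCauchySeqOn_iff]
    intro ε hε
    have h1 := hpair0.eventually (gt_mem_nhds (ENNReal.pow_pos (ENNReal.ofReal_pos.2 hε) 2))
    obtain ⟨N, hN⟩ := eventually_atTop_prod_self'.1 h1
    refine ⟨N, fun m hm n hn t ht => ?_⟩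
    have h2 := lt_of_pow_lt_pow_left' 2 ((hpair m n t ht).trans_lt (hN m hm n hn))
    rwa [edist_lt_ofReal] at h2
  have hex : ∀ t, ∃ L : Lp ℝ 2 (interiorMeasure Ω), t ∈ Icc 0 T →
      Tendsto (fun n => slice hb (hvc n) t) atTop (𝓝 L) := by
    intro t
    by_cases ht : t ∈ Icc 0 T
    · obtain ⟨L, hL⟩ := cauchySeq_tendsto_of_complete (hcauchy.cauchySeq ht)
      exact ⟨L, fun _ => hL⟩
    · exact ⟨0, fun h => absurd h ht⟩
  choose U hU using hex
  refine ⟨U, ⟨?_, slice_ae_eq_of_tendsto hb hvc u.memLp_val.1 hα hU⟩, fun t ht => ?_⟩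
  · exact (hcauchy.tendstoUniformlyOn_of_tendsto hU).continuousOn
      (Frequently.of_forall fun n => continuousOn_slice hb (hvc n) T)
  · have hl : Tendsto (fun n => ‖slice hb (hvc n) t‖ₑ ^ 2) atTop (𝓝 (‖U t‖ₑ ^ 2)) :=
      ENNReal.Tendsto.pow (hU t ht).enorm
    -- `‖v n‖` stays bounded by `α n + ‖u‖` while the residual tends to zero, so only the boundary
    -- term survives.
    have hr : Tendsto (fun n => ENNReal.ofReal C *
        ((α n + eLpNorm u.val 2 Q) * β n + (γ n + ‖g‖ₑ) ^ 2)) atTop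
        (𝓝 (ENNReal.ofReal C * ((0 + eLpNorm u.val 2 Q) * 0 + (0 + ‖g‖ₑ) ^ 2))) :=
      ENNReal.Tendsto.const_mul
        ((ENNReal.Tendsto.mul (hα.add_const _) (by simp) hβ
          (Or.inr (by simpa using u.memLp_val.2.ne))).add
          (ENNReal.Tendsto.pow (hγ.add_const _))) (Or.inr ENNReal.ofReal_ne_top)
    rw [mul_zero, zero_add, zero_add] at hr
    refine le_of_tendsto_of_tendsto' hl hr fun n => ?_
    rw [slice, Lp.enorm_toLp]
    refine (hobs (v n) (hv n) t ht).trans ?_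
    gcongr
    · have h1 := eLpNorm_add_le (p := 2) ((hvc n).aestronglyMeasurable.sub u.memLp_val.1)
        u.memLp_val.1 (by norm_num)
      rwa [sub_add_cancel] at h1
    · have h1 := eLpNorm_add_le (p := 2)
        ((hvc n).aestronglyMeasurable.sub (Lp.aestronglyMeasurable g))
        (Lp.aestronglyMeasurable g) (by norm_num)
      rw [sub_add_cancel] at h1
      rw [Lp.enorm_def]
      exact h1

/-! ### Outward speed and the main theorem -/

lemma turningTime_le {H : ℝ → E d} {T₁ c₀ : ℝ} (hT₁ : 0 ≤ T₁) : turningTime H T₁ c₀ ≤ T₁ :=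
  Real.sSup_le (fun _ hx => hx.1.2) hT₁

/-- The outward speed: `H(t)·(x - x₀) ≥ δ t` as long as the direction of `H'` has not turned. -/
lemma delta_mul_le_inner {Ω : Set (E d)} {H : ℝ → E d} (hH0 : H 0 = 0) {T₁ t₁ c₀ ρ : ℝ}
    (ht₁ : t₁ ≤ T₁) (hH1 : ContDiffOn ℝ 1 H (Icc 0 T₁)) (hρ : 0 < ρ)
    (hHρ : ∀ t ∈ Icc 0 T₁, ρ ≤ ‖deriv1 H T₁ t‖) (hc₀ : 0 < 2 * c₀ ^ 2 - 1) {x₀ x : E d}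
    (hx : x ∈ Ω) (hd : 0 < Metric.infDist x₀ Ω)
    (hangle : ∀ t ∈ Icc 0 t₁, 2 * c₀ ^ 2 - 1 ≤
      inner ℝ (deriv1 H T₁ t) (x - x₀) / (‖deriv1 H T₁ t‖ * ‖x - x₀‖))
    {t : ℝ} (ht : t ∈ Icc 0 t₁) : delta Ω ρ c₀ x₀ * t ≤ inner ℝ (H t) (x - x₀) := by
  have hxd : Metric.infDist x₀ Ω ≤ ‖x - x₀‖ := by
    rw [← dist_eq_norm, dist_comm]
    exact Metric.infDist_le_dist_of_mem hx
  have hsub : Icc 0 t ⊆ Icc 0 T₁ := Icc_subset_Icc_right (ht.2.trans ht₁)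
  have hder : ∀ s ∈ interior (Icc 0 t),
      HasDerivAt (fun s => inner ℝ (H s) (x - x₀)) (inner ℝ (deriv1 H T₁ s) (x - x₀)) s := by
    intro s hs
    rw [interior_Icc] at hs
    have h1 := (hH1.differentiableOn (by simp) s
      (hsub (Ioo_subset_Icc_self hs))).hasDerivWithinAt.hasDerivAt
      (Icc_mem_nhds hs.1 (hs.2.trans_le (ht.2.trans ht₁)))
    have h2 := h1.inner ℝ (hasDerivAt_const s (x - x₀))
    rw [inner_zero_right, zero_add] at h2
    exact h2
  -- Mean value inequality: the derivative `H'(s)·(x - x₀)` is at least `δ`, by the angle condition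
  -- with `|H'| ≥ ρ` and `|x - x₀| ≥ dist(x₀, Ω)`.
  have h := (convex_Icc 0 t).mul_sub_le_image_sub_of_le_deriv
    (f := fun s => inner ℝ (H s) (x - x₀)) (C := delta Ω ρ c₀ x₀)
    ((hH1.continuousOn.mono hsub).inner continuousOn_const)
    (fun s hs => (hder s hs).differentiableAt.differentiableWithinAt) (fun s hs => ?_)
    0 (left_mem_Icc.2 ht.1) t (right_mem_Icc.2 ht.1) ht.1
  · simpa [hH0] using h
  · rw [(hder s hs).deriv]
    have hs' := interior_subset hs
    have h1 := hHρ s (hsub hs')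
    have h2 := hangle s ⟨hs'.1, hs'.2.trans ht.2⟩
    have hpos : 0 < ‖deriv1 H T₁ s‖ * ‖x - x₀‖ := mul_pos (hρ.trans_le h1) (hd.trans_le hxd)
    rw [le_div_iff₀ hpos] at h2
    calc delta Ω ρ c₀ x₀ = (2 * c₀ ^ 2 - 1) * (ρ * Metric.infDist x₀ Ω) := by
          rw [delta]
          ring
      _ ≤ (2 * c₀ ^ 2 - 1) * (‖deriv1 H T₁ s‖ * ‖x - x₀‖) := by gcongr
      _ ≤ _ := h2

end Transport

end

theorem theorem1p1 (d : ℕ) (Ω : Set (Transport.E d)) (hΩ : Transport.IsSmoothBoundedDomain Ω)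
    (T : ℝ) (hT : 0 < T) (c₀ : ℝ) (hc₀ : c₀ ∈ Ioo (1 / Real.sqrt 2) 1)
    (H : ℝ → Transport.E d) (hH : ContinuousOn H (Icc 0 T)) (hH0 : H 0 = 0)
    (T₁ : ℝ) (hT₁ : T₁ ∈ Ioc 0 T) (hH1 : ContDiffOn ℝ 1 H (Icc 0 T₁))
    (ρ : ℝ) (hρ : 0 < ρ) (hHρ : ∀ t ∈ Icc 0 T₁, ρ ≤ ‖Transport.deriv1 H T₁ t‖)
    (x₀ : Transport.E d) (hx₀ : x₀ ∉ closure Ω)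
    (hangle : ∀ x ∈ closure Ω, ∀ t ∈ Icc 0 (Transport.turningTime H T₁ c₀),
      2 * c₀ ^ 2 - 1 ≤
        inner ℝ (Transport.deriv1 H T₁ t) (x - x₀) / (‖Transport.deriv1 H T₁ t‖ * ‖x - x₀‖))
    (htime : Transport.exitTime Ω ρ c₀ x₀ < Transport.turningTime H T₁ c₀) :
    ∃ C : ℝ, 0 < C ∧
      ∀ (g : Lp ℝ 2 (Transport.lateralMeasure Ω T))
        (u : Transport.H1 (Transport.cylinder Ω T)), Transport.IsSolution Ω T H g u →
        ∃ U : ℝ → Lp ℝ 2 (Transport.interiorMeasure Ω), Transport.IsTimeSlice Ω T u U ∧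
          ∀ t ∈ Icc 0 T, ‖U t‖ ≤ C * ‖g‖ := by
  have hb := hΩ.isBounded
  have hc : 0 < 2 * c₀ ^ 2 - 1 := by
    have h1 : 0 < 1 / Real.sqrt 2 := by positivity
    have h2 := pow_lt_pow_left₀ hc₀.1 h1.le two_ne_zero
    rw [div_pow, Real.sq_sqrt (by norm_num)] at h2
    linarith
  have hd := (Metric.infDist_pos_iff_notMem_closure hΩ.isConnected.nonempty).1 hx₀
  have hδ : 0 < Transport.delta Ω ρ c₀ x₀ := mul_pos (mul_pos hρ hc) hd
  have ht₁ : Transport.turningTime H T₁ c₀ ≤ T₁ := Transport.turningTime_le hT₁.1.le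
  have ht₀ : 0 < Transport.turningTime H T₁ c₀ := (Real.sqrt_nonneg _).trans_lt htime
  -- Squaring `T₀ < t₁` gives the gap condition `M - m < δt₁²`.
  rw [Transport.exitTime, Real.sqrt_lt' ht₀, div_lt_iff₀ hδ, mul_comm] at htime
  have himg : IsCompact ((fun x => ‖x - x₀‖ ^ 2) '' closure Ω) :=
    hb.isCompact_closure.image (by fun_prop)
  -- Extending `H` by its endpoint values makes it continuous on all of `ℝ` and leaves the equation
  -- on the cylinder unchanged.
  set H' : ℝ → Transport.E d := IccExtend hT.le ((Icc 0 T).domRestrict H)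
  have hH'c : Continuous H' := (continuousOn_iff_continuous_domRestrict.1 hH).Icc_extend'
  have hH'eq : ∀ t ∈ Icc 0 T, H' t = H t := fun t ht => IccExtend_of_mem hT.le _ ht
  obtain ⟨C, hC, hobs⟩ := Transport.exists_eLpNorm_slice_sq_le hΩ.isOpen hb hH'c
    (x₀ := x₀) ⟨ht₀.le, ht₁.trans hT₁.2⟩
    (fun x hx => csInf_le himg.bddBelow ⟨x, subset_closure hx, rfl⟩)
    (fun x hx => le_csSup himg.bddAbove ⟨x, subset_closure hx, rfl⟩)
    (fun x hx t ht => by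
      rw [hH'eq t ⟨ht.1, ht.2.trans (ht₁.trans hT₁.2)⟩]
      exact Transport.delta_mul_le_inner hH0 ht₁ hH1 hρ hHρ hc hx hd
        (hangle x (subset_closure hx)) ht) htime
  refine ⟨Real.sqrt C, Real.sqrt_pos.2 hC, fun g u hu => ?_⟩
  have hu' : Transport.IsSolution Ω T H' g u := by
    refine ⟨?_, hu.boundary⟩
    filter_upwards [hu.equation, ae_restrict_mem (hΩ.isOpen.measurableSet.prod measurableSet_Ioo)]
      with p hp hpQ
    rwa [hH'eq _ (Ioo_subset_Icc_self hpQ.2)]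
  obtain ⟨U, hU, hUb⟩ := Transport.exists_isTimeSlice hb hH'c hobs hu'
  refine ⟨U, hU, fun t ht => ?_⟩
  have h1 := ENNReal.toReal_mono (by simp [ENNReal.mul_eq_top]) (hUb t ht)
  simp only [ENNReal.toReal_mul, ENNReal.toReal_pow, toReal_enorm, ENNReal.toReal_ofReal hC.le] at h1
  refine le_of_sq_le_sq ?_ (by positivity)
  rwa [mul_pow, Real.sq_sqrt hC.le]
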